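/- **Theorem.** Fix a finite nonempty alphabet $\Lambda=\{0,1,\dots,m\}$. *Definitions.* A module $M$ with finite node set $S$ and finite input set $I$ (disjoint) consists of a local function $f_s:\Lambda^{S\cup I}\to\Lambda$ for each $s\in S$. A node $s$ influences a node $s'$ if $f_{s'}$ takes different values at some two configurations in $\Lambda^{S\cup I}$ that differ exactly at $s$; $M$ is acyclic if the digraph on $S$ whose arcs are the pairs $(s,s')$ such that $s$ influences $s'$ has no directed cycle (loops included). A complete recursive wiring is a function $\omega:I\to S$; the wired network $F=\circlearrowright_\omega M$ is the map $F:\Lambda^S\to\Lambda^S$ with $F(x)_s=f_s(x')$, where $x'_t=x_t$ for $t\in S$ and $x'_\alpha=x_{\omega(\alpha)}$ for $\alpha\in I$. The dynamics of $F$ is the digraph on $\Lambda^S$ with the arcs $(x,F(x))$. An attractor of $F$ is a connected component of the subdigraph of the dynamics induced on the configurations $x$ such that $F^t(x)=x$ for some $t\ge 1$; its size is its number of configurations. The *Acyclic Module Attractor Problem* over $\Lambda$ is: given an acyclic module $M$ over $\Lambda$ with $k$ inputs, a complete recursive wiring $\omega$ of $M$, and a number $c\in\mathbb{N}$ in unary,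 does $\circlearrowright_\omega M$ have an attractor of size $c$? (Acyclicity is part of the input's specification: nothing is required of an algorithm on other inputs.) *Encoding.* The module is given by the list of its local functions written in propositional logic, as formulas built with $\top,\bot,\neg,\wedge,\vee$ from the atoms "$x_v=a$" ($v\in S\cup I$, $a\in\Lambda\setminus\{0\}$): for each node $s$ there is one formula $\varphi_{s,a}$ for each $a\in\Lambda\setminus\{0\}$, and $f_s(x)$ is the largest $a$ such that $\varphi_{s,a}$ holds at $x$, or $0$ if there is none. (For $\Lambda=\{0,1\}$ this is one ordinary propositional formula for each node.) An instance is written as a word over a fixed finite alphabet: first $c$, then $\omega$ as the list of its values, then for each node its formulas in prefix notation, with nodes, inputs and letters numbered in unary. Let $N$ be the length of this word. *Claim.* There are a multi-tape Turing machine, a computable function $f:\mathbb{N}\to\mathbb{N}$ and a polynomial $q$ with coefficients in $\mathbb{N}$ (all three depending only on $\Lambda$) such that the machine solves the Acyclic Module Attractor Problem over $\Lambda$, using on every instance at most $f(k\cdot c)\,q(N)$ steps. That is, the problem is fixed-parameter tractable in the parameter $k\cdot c$. -/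

import Mathlib

namespace AutomataNet

/-! ### Automata networks, their dynamics and attractors -/

/-- An automata network over the node set `S` and the alphabet `A`: a local function for each
node. -/
def Network (S A : Type) : Type := S → (S → A) → A

/-- The parallel update of a configuration. -/
def Network.update {S A : Type} (F : Network S A) (x : S → A) : S → A := fun s => F s x

/-- The dynamics of a network: the digraph on configurations with an arc from `x` to `x'` if and
only if `F(x) = x'`. -/
def Network.dynamics {S A : Type} (F : Network S A) : Digraph (S → A) where
  Adj x x' := F.update x = x'

/-- The configurations `x` with `F^t(x) = x` for some `t ≥ 1`. -/
def Network.recurrent {S A : Type} (F : Network S A) : Set (S → A) :=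
  {x | ∃ t : ℕ, t ≠ 0 ∧ F.update^[t] x = x}

/-- An attractor: the vertex set of a connected component of the subdigraph of the dynamics
induced on the recurrent configurations. -/
def Network.IsAttractor {S A : Type} (F : Network S A) (X : Set (S → A)) : Prop :=
  ∃ x ∈ F.recurrent, X = {y | Relation.EqvGen
    (fun u v => u ∈ F.recurrent ∧ v ∈ F.recurrent ∧ F.dynamics.Adj u v) x y}

/-! ### Modules and complete recursive wirings -/

/-- A module with node set `S`, input set `I` and alphabet `A`: a local function on
configurations of the disjoint union of `S` and `I`, for each node. -/
def AModule (S I A : Type) : Type := S → (S ⊕ I → A) → A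

/-- The label `v` (a node or an input) influences the node `s`. -/
def AModule.Influences {S I A : Type} (M : AModule S I A) (v : S ⊕ I) (s : S) : Prop :=
  ∃ x x' : S ⊕ I → A, (∀ r, r ≠ v ↔ x r = x' r) ∧ M s x ≠ M s x'

/-- The interaction digraph of a module, on its nodes. (Inputs have no local function, hence no
incoming arc, and never lie on a cycle.) -/
def AModule.interactionDigraph {S I A : Type} (M : AModule S I A) : Digraph S where
  Adj s s' := M.Influences (Sum.inl s) s'

/-- A module is acyclic if its interaction digraph has no directed cycle (loops included). -/
def AModule.IsAcyclic {S I A : Type} (M : AModule S I A) : Prop :=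
  ∀ s, ¬ Relation.TransGen M.interactionDigraph.Adj s s

/-- The complete recursive wiring `↻_ω M`: each input `α` is replaced by the node `ω α`. -/
def AModule.wire {S I A : Type} (M : AModule S I A) (ω : I → S) : Network S A :=
  fun s x => M s (x ∘ Sum.elim id ω)

/-! ### Modules written in propositional logic -/

/-- Propositional formulas over the atoms `V`. -/
inductive Formula (V : Type) : Type
  | tru : Formula V
  | fls : Formula V
  | atom : V → Formula V
  | neg : Formula V → Formula V
  | and : Formula V → Formula V → Formula V
  | or : Formula V → Formula V → Formula V

/-- The truth value of a formula under a valuation of its atoms. -/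
def Formula.eval {V : Type} (ρ : V → Bool) : Formula V → Bool
  | tru => true
  | fls => false
  | atom v => ρ v
  | neg φ => !(φ.eval ρ)
  | and φ ψ => φ.eval ρ && ψ.eval ρ
  | or φ ψ => φ.eval ρ || ψ.eval ρ

/-- A written module with `n` nodes and `k` inputs over the alphabet `{0, …, m}`: for each node
`s`, one formula `φ_{s,a}` for each nonzero letter `a = 1, …, m`. The atom `(v, a)` says that the
label `v` has the letter `a`. An index `a : Fin m` stands for the nonzero letter
`a.succ : Fin (m + 1)`.

For `m = 1`, the Boolean case, this is one propositional formula for each node, in the variables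
that are the nodes and the inputs. -/
abbrev ModuleCode (m n k : ℕ) : Type := Fin n → Fin m → Formula ((Fin n ⊕ Fin k) × Fin m)

/-- The module that is written: `f_s(x)` is the largest nonzero letter `a` such that `φ_{s,a}`
holds at `x`, and `0` if there is none. -/
noncomputable def ModuleCode.toModule {m n k : ℕ} (P : ModuleCode m n k) :
    AModule (Fin n) (Fin k) (Fin (m + 1)) :=
  fun s x => (Finset.univ.filter fun a : Fin m =>
    (P s a).eval (fun p => decide (x p.1 = p.2.succ)) = true).sup Fin.succ

/-! ### The Acyclic Module Attractor Problem -/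

/-- An instance of the Acyclic Module Attractor Problem over the alphabet `{0, …, m}`: an acyclic
module with `n` nodes and `k` inputs, a complete recursive wiring, and a number `c`. -/
structure AttractorInstance (m : ℕ) : Type where
  n : ℕ
  k : ℕ
  code : ModuleCode m n k
  acyclic : code.toModule.IsAcyclic
  wiring : Fin k → Fin n
  c : ℕ

/-- The question: does the wired module have an attractor of size `c`? -/
def AttractorInstance.HasAttractor {m : ℕ} (J : AttractorInstance m) : Prop :=
  ∃ X, (J.code.toModule.wire J.wiring).IsAttractor X ∧ X.Finite ∧ X.ncard = J.c

/-! ### Instances as words -/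

/-- The input alphabet of the algorithms. -/
inductive Token : Type
  | tick | sep
  | wireMark | nodeMark | formulaMark
  | nodeAtom | inputAtom
  | tru | fls | neg | and | or
  deriving DecidableEq

/-- The input alphabet is finite. -/
instance : Fintype Token where
  elems := {.tick, .sep, .wireMark, .nodeMark, .formulaMark, .nodeAtom, .inputAtom, .tru, .fls,
    .neg, .and, .or}
  complete t := by cases t <;> simp

/-- Unary code of a number, followed by an end mark. -/
def encodeNum (a : ℕ) : List Token := List.replicate a Token.tick ++ [Token.sep]

/-- Code of an atom: its kind, the number of the node or input, the number of the letter. -/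
def encodeAtom {m n k : ℕ} : (Fin n ⊕ Fin k) × Fin m → List Token
  | (Sum.inl s, a) => Token.nodeAtom :: (encodeNum s ++ encodeNum a)
  | (Sum.inr α, a) => Token.inputAtom :: (encodeNum α ++ encodeNum a)

/-- Code of a formula, in Polish (prefix) notation. -/
def encodeFormula {m n k : ℕ} : Formula ((Fin n ⊕ Fin k) × Fin m) → List Token
  | .tru => [Token.tru]
  | .fls => [Token.fls]
  | .atom p => encodeAtom p
  | .neg φ => Token.neg :: encodeFormula φ
  | .and φ ψ => Token.and :: (encodeFormula φ ++ encodeFormula ψ)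
  | .or φ ψ => Token.or :: (encodeFormula φ ++ encodeFormula ψ)

/-- Code of an instance: the number `c` in unary, then for each input the node it is wired to,
then for each node the list of its formulas. -/
def AttractorInstance.encode {m : ℕ} (J : AttractorInstance m) : List Token :=
  encodeNum J.c
  ++ (List.ofFn fun α => Token.wireMark :: encodeNum (J.wiring α)).flatten
  ++ (List.ofFn fun s => Token.nodeMark ::
      (List.ofFn fun a => Token.formulaMark :: encodeFormula (J.code s a)).flatten).flatten

/-! ### Deciding a problem within a time bound -/

/-- The problem `Q`, with instances `J : α` given as words `enc J`, is decided by one (multi-stack)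
Turing machine that on each instance `J` halts with the correct answer after at most `T J`
steps. -/
def DecidableInTime {α Γ : Type} (enc : α → List Γ) (Q : α → Prop) (T : α → ℕ) : Prop :=
  ∃ M : Turing.TM2ComputableAux Γ Bool, ∀ J : α, ∃ b : Bool, (b = true ↔ Q J) ∧
    Nonempty (Turing.TM2OutputsInTime M.tm ((enc J).map M.inputAlphabet.symm)
      (some ([b].map M.outputAlphabet.symm)) (T J))

end AutomataNet

/-! On the recurrent configurations the wired network F permutes, so its attractors are exactly its
cycles. The question becomes whether some configuration has minimal period c, with c > 0
(`Network.exists_isAttractor_iff`).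

An acyclic module forgets its past. After t updates under prescribed input letters, the letter of a
node with fewer than t ancestors depends on these letters alone, so after n = |S| updates the
initial configuration is lost (`AModule.IsAcyclic.foldl_update_eq`). Suppose F^c(x) = x, and let v
be the sequence of the c tuples of input letters read along the orbit of x. Feeding v repeatedly to
the module, starting from x, reproduces that orbit; after n rounds the result is x again. As at
least n updates have been made, the same n rounds started from the configuration 0 also end at x. So
every configuration of period c is `reached` from some v in (Λ^k)^c, and there are only (m+1)^(kc)
such sequences.

The algorithm tries all of them. For each it computes the configuration reached, iterates F on it c
times, and accepts if the first return is at time c. Acyclicity is needed only so that no cycle is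
missed; a successful trial exhibits a cycle by itself (`AttractorInstance.hasAttractor_iff`). One
trial takes polynomial time, whence f(x) = (m+1)^x.

For the step count, the algorithm is a program in a small language of stack operations, whose runs
are simulated step by step by a Turing machine (`StackProg.Run.iterate_step`). The module is
evaluated by reading its word backwards: formulas in prefix notation then become postfix and are
evaluated with a stack of truth values. -/

/-! ### A structured language for stack machines -/

/-- Programs over a family of stacks: `case` pops a symbol and branches on it, `loop` pops symbols
and runs the body on each of them until the stack is empty. -/
inductive StackProg {K : Type} (Γ : K → Type) : Type
  | skip : StackProg Γ
  | push (k : K) (x : Γ k) : StackProg Γ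
  | seq (p q : StackProg Γ) : StackProg Γ
  | case (k : K) (f : Option (Γ k) → StackProg Γ) : StackProg Γ
  | loop (k : K) (f : Γ k → StackProg Γ) : StackProg Γ

namespace StackProg

open Turing Function

variable {K : Type} {Γ : K → Type}

/-- The control points of a program. -/
def Label : StackProg Γ → Type
  | skip => Unit
  | push _ _ => Unit
  | seq p q => p.Label ⊕ q.Label
  | case _ f => Unit ⊕ (Σ o, (f o).Label)
  | loop _ f => Unit ⊕ (Σ x, (f x).Label)

/-- The control point at which a program starts. -/
def entry : (p : StackProg Γ) → p.Label
  | skip => ()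
  | push _ _ => ()
  | seq p _ => Sum.inl p.entry
  | case _ _ => Sum.inl ()
  | loop _ _ => Sum.inl ()

theorem finite_label [∀ k, Finite (Γ k)] (p : StackProg Γ) : Finite p.Label := by
  induction p with
  | skip => exact inferInstanceAs (Finite Unit)
  | push k x => exact inferInstanceAs (Finite Unit)
  | seq p q hp hq => exact @Finite.instSum _ _ hp hq
  | case k f hf =>
    have : ∀ o, Finite (f o).Label := hf
    exact inferInstanceAs (Finite (Unit ⊕ (Σ o, (f o).Label)))
  | loop k f hf =>
    have : ∀ x, Finite (f x).Label := hf
    exact inferInstanceAs (Finite (Unit ⊕ (Σ x, (f x).Label)))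

/-! ### Compilation to a multi-stack machine, and its correctness -/

variable [DecidableEq K]

/-- The machine statements of a program whose control points are embedded by `e` into the labels of
a machine, and that leaves to the label `x`. The internal state remembers the symbol last popped
from each stack. -/
def compile {Λ : Type} : (p : StackProg Γ) → (p.Label → Λ) → Λ → p.Label →
    TM2.Stmt Γ Λ (∀ k, Option (Γ k))
  | skip, _, x, _ => .goto fun _ => x
  | push k a, _, x, _ => .push k (fun _ => a) (.goto fun _ => x)
  | seq p q, e, x, l => Sum.elim (p.compile (e ∘ Sum.inl) (e (Sum.inr q.entry)))
      (q.compile (e ∘ Sum.inr) x) l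
  | case k f, e, x, l => Sum.elim
      (fun _ => .pop k (fun v o => update v k o) (.goto fun v => e (Sum.inr ⟨v k, (f (v k)).entry⟩)))
      (fun l => (f l.1).compile (fun l' => e (Sum.inr ⟨l.1, l'⟩)) x l.2) l
  | loop k f, e, x, l => Sum.elim
      (fun _ => .pop k (fun v o => update v k o) (.goto fun v =>
        (v k).elim x fun a => e (Sum.inr ⟨a, (f a).entry⟩)))
      (fun l => (f l.1).compile (fun l' => e (Sum.inr ⟨l.1, l'⟩)) (e (Sum.inl ())) l.2) l

/-- `Run p s t s'`: started on the stacks `s`, the program `p` ends on the stacks `s'` after exactly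
`t` steps. -/
inductive Run : StackProg Γ → (∀ k, List (Γ k)) → ℕ → (∀ k, List (Γ k)) → Prop
  | skip (s) : Run skip s 1 s
  | push (k x s) : Run (push k x) s 1 (update s k (x :: s k))
  | seq {p q s t s' t' s''} : Run p s t s' → Run q s' t' s'' → Run (seq p q) s (t + t') s''
  | case_nil {k f s t s'} : s k = [] → Run (f none) s t s' → Run (case k f) s (1 + t) s'
  | case_cons {k f s t s' x l} : s k = x :: l → Run (f (some x)) (update s k l) t s' →
      Run (case k f) s (1 + t) s'
  | loop_nil {k f s} : s k = [] → Run (loop k f) s 1 s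
  | loop_cons {k f s t s' t' s'' x l} : s k = x :: l → Run (f x) (update s k l) t s' →
      Run (loop k f) s' t' s'' → Run (loop k f) s (1 + t + t') s''

theorem stepAux_pop_goto {Λ : Type} (k : K) (g : Option (Γ k) → Λ) (v : ∀ k, Option (Γ k))
    (s : ∀ k, List (Γ k)) :
    TM2.stepAux (.pop k (fun v o => update v k o) (.goto fun v => g (v k))) v s =
      ⟨some (g (s k).head?), update v k (s k).head?, update s k (s k).tail⟩ := by
  simp

/-- Induction on the run. The machine `M`, the embedding `e` and the exit `x` are arbitrary because
subprograms sit inside larger machines: the body of a loop exits to the test of that loop. The final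
internal state is left unspecified, since every branching follows a fresh pop. -/
theorem Run.iterate_step {p : StackProg Γ} {s s' : ∀ k, List (Γ k)} {t : ℕ} (h : Run p s t s')
    {Λ : Type} (M : Λ → TM2.Stmt Γ Λ (∀ k, Option (Γ k))) (e : p.Label → Λ) (x : Λ)
    (hM : ∀ l, M (e l) = p.compile e x l) (v : ∀ k, Option (Γ k)) :
    ∃ v', (flip bind (TM2.step M))^[t] (some ⟨some (e p.entry), v, s⟩) =
      some ⟨some x, v', s'⟩ := by
  have one (c : TM2.Cfg Γ Λ (∀ k, Option (Γ k))) :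
      (flip bind (TM2.step M))^[1] (some c) = TM2.step M c := rfl
  induction h generalizing x v with
  | skip s => exact ⟨v, by rw [one, TM2.step, hM]; rfl⟩
  | push k a s => exact ⟨v, by rw [one, TM2.step, hM]; rfl⟩
  | seq _ _ ih₁ ih₂ =>
    obtain ⟨v₁, h₁⟩ := ih₁ (e ∘ Sum.inl) _ (fun l => hM (Sum.inl l)) v
    obtain ⟨v₂, h₂⟩ := ih₂ (e ∘ Sum.inr) _ (fun l => hM (Sum.inr l)) v₁
    refine ⟨v₂, ?_⟩
    rw [add_comm, iterate_add_apply, ← h₂]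
    exact congrArg _ h₁
  | @case_nil k f s t s' hs _ ih =>
    obtain ⟨v₁, h₁⟩ := ih (fun l' => e (Sum.inr ⟨none, l'⟩)) x (fun l => hM (Sum.inr ⟨none, l⟩))
      (update v k none)
    refine ⟨v₁, ?_⟩
    rw [add_comm, iterate_add_apply, one, ← h₁]
    refine congrArg _ ((congrArg some (congrArg (TM2.stepAux · v s) (hM (Sum.inl ())))).trans ?_)
    refine (congrArg some (stepAux_pop_goto k (fun o => e (Sum.inr ⟨o, (f o).entry⟩)) v s)).trans ?_
    -- Popping from an empty stack leaves the stacks unchanged.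
    rw [hs, List.tail_nil, ← hs, update_eq_self, hs]
    rfl
  | @case_cons k f s t s' a l hs _ ih =>
    obtain ⟨v₁, h₁⟩ := ih (fun l' => e (Sum.inr ⟨some a, l'⟩)) x
      (fun l => hM (Sum.inr ⟨some a, l⟩)) (update v k (some a))
    refine ⟨v₁, ?_⟩
    rw [add_comm, iterate_add_apply, one, ← h₁]
    refine congrArg _ ((congrArg some (congrArg (TM2.stepAux · v s) (hM (Sum.inl ())))).trans ?_)
    refine (congrArg some (stepAux_pop_goto k (fun o => e (Sum.inr ⟨o, (f o).entry⟩)) v s)).trans ?_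
    rw [hs]
    rfl
  | @loop_nil k f s hs =>
    refine ⟨update v k none, ?_⟩
    rw [one]
    refine (congrArg some (congrArg (TM2.stepAux · v s) (hM (Sum.inl ())))).trans ?_
    refine (congrArg some (stepAux_pop_goto k (fun o => o.elim x fun a =>
      e (Sum.inr ⟨a, (f a).entry⟩)) v s)).trans ?_
    rw [hs, List.tail_nil, ← hs, update_eq_self, hs]
    rfl
  | @loop_cons k f s t s' t' s'' a l hs _ _ ih₁ ih₂ =>
    obtain ⟨v₁, h₁⟩ := ih₁ (fun l' => e (Sum.inr ⟨a, l'⟩)) (e (Sum.inl ()))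
      (fun l => hM (Sum.inr ⟨a, l⟩)) (update v k (some a))
    obtain ⟨v₂, h₂⟩ := ih₂ e x hM v₁
    refine ⟨v₂, ?_⟩
    rw [add_comm, iterate_add_apply, add_comm, iterate_add_apply, one, ← h₂]
    refine congrArg _ (Eq.trans ?_ h₁)
    refine congrArg _ ((congrArg some (congrArg (TM2.stepAux · v s) (hM (Sum.inl ())))).trans ?_)
    refine (congrArg some (stepAux_pop_goto k (fun o => o.elim x fun a =>
      e (Sum.inr ⟨a, (f a).entry⟩)) v s)).trans ?_
    rw [hs]
    rfl

/-- The machine of a program: it runs the program, resets the internal state and halts. -/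
noncomputable def toFinTM2 [Fintype K] [∀ k, Fintype (Γ k)] (p : StackProg Γ) (k₀ k₁ : K) :
    FinTM2 where
  K := K
  k₀ := k₀
  k₁ := k₁
  Γ := Γ
  Λ := p.Label ⊕ Unit
  main := Sum.inl p.entry
  ΛFin := by
    have := p.finite_label
    exact Fintype.ofFinite _
  σ := ∀ k, Option (Γ k)
  initialState := fun _ => none
  m := Sum.elim (p.compile Sum.inl (Sum.inr ())) fun _ => .load (fun _ _ => none) .halt

theorem dite_nil_eq_update (k₀ : K) (i : List (Γ k₀)) :
    (fun k => if h : k = k₀ then (by rw [h]; exact i : List (Γ k)) else []) =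
      update (fun _ => []) k₀ i := by
  funext k
  rcases eq_or_ne k₀ k with rfl | hk
  · simp
  · simp [hk.symm]

/-- The additional step is the one that resets the internal state and halts. -/
theorem Run.outputsInTime [Fintype K] [∀ k, Fintype (Γ k)] {p : StackProg Γ} {k₀ k₁ : K}
    {i : List (Γ k₀)} {o : List (Γ k₁)} {t T : ℕ}
    (h : Run p (update (fun _ => []) k₀ i) t (update (fun _ => []) k₁ o)) (hT : t + 1 ≤ T) :
    Nonempty (TM2OutputsInTime (p.toFinTM2 k₀ k₁) i (some o) T) := by
  obtain ⟨v', h'⟩ := h.iterate_step (p.toFinTM2 k₀ k₁).m Sum.inl (Sum.inr ()) (fun _ => rfl)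
    fun _ => none
  have hi : initList (p.toFinTM2 k₀ k₁) i =
      ⟨some (Sum.inl p.entry), fun _ => none, update (fun _ => []) k₀ i⟩ := by
    unfold initList
    congr 1
    exact dite_nil_eq_update k₀ i
  have ho : haltList (p.toFinTM2 k₀ k₁) o =
      ⟨none, fun _ => none, update (fun _ => []) k₁ o⟩ := by
    unfold haltList
    congr 1
    exact dite_nil_eq_update k₁ o
  refine ⟨⟨⟨t + 1, ?_⟩, hT⟩⟩
  rw [iterate_succ_apply', hi]
  refine (congrArg (flip bind (TM2.step (p.toFinTM2 k₀ k₁).m)) h').trans ?_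
  exact congrArg some ho.symm

end StackProg

namespace AutomataNet

open Function

/-! ### Attractors and minimal periods -/

theorem Network.mem_recurrent_iff {S A : Type} (F : Network S A) (x : S → A) :
    x ∈ F.recurrent ↔ x ∈ periodicPts F.update := by
  simp [Network.recurrent, periodicPts, IsPeriodicPt, IsFixedPt, Nat.pos_iff_ne_zero]

/-- Arcs between recurrent configurations can be followed backwards along the cycle, so the forward
orbit is closed under arcs in both directions. -/
theorem Network.component_eq_orbit {S A : Type} (F : Network S A) {x : S → A}
    (hx : x ∈ F.recurrent) :
    {y | Relation.EqvGen (fun u v => u ∈ F.recurrent ∧ v ∈ F.recurrent ∧ F.dynamics.Adj u v) x y} =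
      Set.range fun t : ℕ => F.update^[t] x := by
  have step : ∀ u ∈ F.recurrent, F.update u ∈ F.recurrent := by
    rintro u ⟨t, ht, h⟩
    exact ⟨t, ht, by rw [← iterate_succ_apply, iterate_succ_apply', h]⟩
  ext y
  constructor
  · intro h
    suffices H : ∀ u v, Relation.EqvGen
        (fun u v => u ∈ F.recurrent ∧ v ∈ F.recurrent ∧ F.dynamics.Adj u v) u v →
        ((∃ t : ℕ, F.update^[t] x = u) ↔ ∃ t : ℕ, F.update^[t] x = v) from
      (H x y h).1 ⟨0, rfl⟩
    intro u v h
    induction h with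
    | rel u v h =>
      obtain ⟨⟨p, hp, hu⟩, -, huv⟩ := h
      constructor
      · rintro ⟨t, rfl⟩
        exact ⟨t + 1, by rw [iterate_succ_apply']; exact huv⟩
      · rintro ⟨t, ht⟩
        -- If `u` returns after `p + 1` steps and its image is `v`, then `u` is the `p`-th iterate
        -- of `v`.
        obtain ⟨p, rfl⟩ := Nat.exists_eq_succ_of_ne_zero hp
        refine ⟨p + t, ?_⟩
        rw [iterate_add_apply, ht, ← show F.update u = v from huv, ← iterate_succ_apply, hu]
    | refl => rfl
    | symm _ _ _ ih => exact ih.symm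
    | trans _ _ _ _ _ ih₁ ih₂ => exact ih₁.trans ih₂
  · rintro ⟨t, rfl⟩
    have h : ∀ t : ℕ, F.update^[t] x ∈ F.recurrent := by
      intro t
      induction t with
      | zero => exact hx
      | succ t ih => rw [iterate_succ_apply']; exact step _ ih
    change Relation.EqvGen _ x (F.update^[t] x)
    induction t with
    | zero => exact .refl _
    | succ t ih =>
      exact ih.trans _ _ _ (.rel _ _ ⟨h t, h (t + 1), by rw [iterate_succ_apply']; rfl⟩)

theorem finite_orbit_and_ncard {α : Type} (f : α → α) {x : α} (hx : x ∈ periodicPts f) :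
    (Set.range fun t : ℕ => f^[t] x).Finite ∧
      (Set.range fun t : ℕ => f^[t] x).ncard = minimalPeriod f x := by
  have h : (Set.range fun t : ℕ => f^[t] x) =
      (fun t : ℕ => f^[t] x) '' Set.Iio (minimalPeriod f x) := by
    ext y
    constructor
    · rintro ⟨t, rfl⟩
      exact ⟨t % minimalPeriod f x, Nat.mod_lt _ (minimalPeriod_pos_of_mem_periodicPts hx),
        iterate_mod_minimalPeriod_eq⟩
    · rintro ⟨t, -, rfl⟩
      exact ⟨t, rfl⟩
  rw [h]
  refine ⟨(Set.finite_Iio _).image _, ?_⟩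
  rw [iterate_injOn_Iio_minimalPeriod.ncard_image, Set.ncard_eq_toFinset_card']
  simp

/-- `minimalPeriod` is `0` at non-periodic points, so `0 < c` excludes them; and attractors are
nonempty, so none has size `0`. -/
theorem Network.exists_isAttractor_iff {S A : Type} (F : Network S A) (c : ℕ) :
    (∃ X, F.IsAttractor X ∧ X.Finite ∧ X.ncard = c) ↔
      ∃ x, 0 < c ∧ minimalPeriod F.update x = c := by
  constructor
  · rintro ⟨X, ⟨x, hx, rfl⟩, -, hc⟩
    have hp := (F.mem_recurrent_iff x).1 hx
    rw [F.component_eq_orbit hx, (finite_orbit_and_ncard _ hp).2] at hc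
    exact ⟨x, hc ▸ minimalPeriod_pos_of_mem_periodicPts hp, hc⟩
  · rintro ⟨x, hc, h⟩
    have hp : x ∈ periodicPts F.update := minimalPeriod_pos_iff_mem_periodicPts.1 (h ▸ hc)
    have hx := (F.mem_recurrent_iff x).2 hp
    refine ⟨_, ⟨x, hx, rfl⟩, ?_⟩
    rw [F.component_eq_orbit hx]
    exact ⟨(finite_orbit_and_ncard _ hp).1, (finite_orbit_and_ncard _ hp).2.trans h⟩

theorem minimalPeriod_eq_iff {α : Type} (f : α → α) (x : α) {c : ℕ} (hc : 0 < c) :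
    minimalPeriod f x = c ↔ f^[c] x = x ∧ ∀ t, 0 < t → t < c → f^[t] x ≠ x := by
  constructor
  · rintro rfl
    exact ⟨iterate_minimalPeriod, fun t h0 h =>
      not_isPeriodicPt_of_pos_of_lt_minimalPeriod h0.ne' h⟩
  · rintro ⟨h, h'⟩
    have h1 : minimalPeriod f x ≤ c := IsPeriodicPt.minimalPeriod_le hc h
    by_contra hne
    exact h' _ (IsPeriodicPt.minimalPeriod_pos hc h) (lt_of_le_of_ne h1 hne) iterate_minimalPeriod

/-! ### Acyclic modules forget their initial configuration -/

/-- Influence compares configurations that differ at one label only, so `x` is turned into `y` one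
label at a time; finiteness lets this reach all labels. -/
theorem AModule.eq_of_forall_not_influences {S I A : Type} [Finite S] [Finite I] (M : AModule S I A)
    (s : S) (x y : S ⊕ I → A) (h : ∀ v, x v ≠ y v → ¬ M.Influences v s) : M s x = M s y := by
  classical
  have := Fintype.ofFinite S
  have := Fintype.ofFinite I
  have key : ∀ D : Finset (S ⊕ I), M s (D.piecewise y x) = M s x := by
    intro D
    induction D using Finset.induction_on with
    | empty => simp
    | insert v D hv ih =>
      rw [← ih]
      by_cases hxy : x v = y v
      · congr 1
        rw [Finset.piecewise_insert]
        refine update_eq_self_iff.2 ?_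
        rw [Finset.piecewise_eq_of_notMem _ _ _ hv, hxy]
      · by_contra hne
        refine h v hxy ⟨_, _, fun r => ?_, hne⟩
        rw [Finset.piecewise_insert]
        by_cases hr : r = v
        · subst hr
          simpa [hv] using Ne.symm hxy
        · simp [hr]
  simpa using (key Finset.univ).symm

/-- The update of a module on a configuration and input letters. -/
def AModule.update {S I A : Type} (M : AModule S I A) (x : S → A) (v : I → A) : S → A :=
  fun s => M s (Sum.elim x v)

theorem AModule.wire_update {S I A : Type} (M : AModule S I A) (ω : I → S) (x : S → A) :
    (M.wire ω).update x = M.update x (x ∘ ω) := by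
  funext s
  simp [AModule.wire, Network.update, AModule.update, Sum.comp_elim]

/-- The number of nodes with a path to `s`. -/
noncomputable def AModule.height {S I A : Type} (M : AModule S I A) (s : S) : ℕ :=
  {s' | Relation.TransGen M.interactionDigraph.Adj s' s}.ncard

/-- Ancestors of `s` are ancestors of `s'`, and `s` is an ancestor of `s'` but, by acyclicity, not
of itself. -/
theorem AModule.IsAcyclic.height_lt {S I A : Type} [Finite S] {M : AModule S I A}
    (hM : M.IsAcyclic) {s s' : S} (h : M.Influences (Sum.inl s) s') : M.height s < M.height s' := by
  refine Set.ncard_lt_ncard ⟨fun r hr => Relation.TransGen.tail hr h, fun hsub => ?_⟩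
  exact hM s (hsub (Relation.TransGen.single h))

theorem AModule.IsAcyclic.height_lt_card {S I A : Type} [Finite S] {M : AModule S I A}
    (hM : M.IsAcyclic) (s : S) : M.height s < Nat.card S := by
  rw [← Set.ncard_univ]
  exact Set.ncard_lt_ncard ⟨fun _ _ => trivial, fun hsub => hM s (hsub trivial)⟩

/-- Induction on the input sequence from its end: the letter of `s` after the last update depends on
the inputs just read, which are common to both runs, and on nodes of smaller height, which already
agree. All heights are below the number of nodes. -/
theorem AModule.IsAcyclic.foldl_update_eq {S I A : Type} [Finite S] [Finite I] {M : AModule S I A}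
    (hM : M.IsAcyclic) (vs : List (I → A)) (h : Nat.card S ≤ vs.length) (x y : S → A) :
    vs.foldl M.update x = vs.foldl M.update y := by
  have key : ∀ vs : List (I → A), ∀ s, M.height s < vs.length →
      vs.foldl M.update x s = vs.foldl M.update y s := by
    intro vs
    induction vs using List.reverseRecOn with
    | nil => simp
    | append_singleton vs v ih =>
      intro s hs
      simp only [List.foldl_append, List.foldl_cons, List.foldl_nil, AModule.update]
      apply M.eq_of_forall_not_influences
      rintro (r | α) hr hinf
      · refine hr (ih r ?_)
        have := hM.height_lt hinf
        simp at hs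
        omega
      · exact hr rfl
  funext s
  exact key vs s ((hM.height_lt_card s).trans_le h)

/-- The input letters read along the orbit of `x` during `c` steps. -/
def AModule.inputTrace {S I A : Type} (M : AModule S I A) (ω : I → S) (x : S → A) (c : ℕ) :
    List (I → A) :=
  (List.range c).map fun t => (M.wire ω).update^[t] x ∘ ω

theorem AModule.foldl_inputTrace {S I A : Type} (M : AModule S I A) (ω : I → S) (x : S → A)
    (c : ℕ) : (M.inputTrace ω x c).foldl M.update x = (M.wire ω).update^[c] x := by
  induction c with
  | zero => rfl
  | succ c ih =>
    rw [AModule.inputTrace, List.range_succ, List.map_append, List.foldl_append, iterate_succ_apply',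
      AModule.wire_update]
    rw [AModule.inputTrace] at ih
    rw [ih]
    rfl

theorem foldl_flatten_replicate {α β : Type} (f : α → β → α) (l : List β) (n : ℕ) (x : α) :
    (List.replicate n l).flatten.foldl f x = (fun x => l.foldl f x)^[n] x := by
  induction n generalizing x with
  | zero => rfl
  | succ n ih => rw [List.replicate_succ, List.flatten_cons, List.foldl_append, ih,
      iterate_succ_apply]

/-- The configurations of period `c` of a wired acyclic module are reached from any configuration,
by feeding a suitable periodic sequence of input letters. -/
theorem AModule.IsAcyclic.exists_iterate_foldl_eq {S I A : Type} [Finite S] [Finite I]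
    {M : AModule S I A} (hM : M.IsAcyclic) (ω : I → S) (x x₀ : S → A) {c : ℕ} (hc : 0 < c)
    (hx : (M.wire ω).update^[c] x = x) :
    ∃ vs : List (I → A), vs.length = c ∧
      (fun y => vs.foldl M.update y)^[Nat.card S] x₀ = x := by
  refine ⟨M.inputTrace ω x c, by simp [AModule.inputTrace], ?_⟩
  -- The `Nat.card S` rounds form one input sequence, long enough (as `0 < c`) for `x₀` to be
  -- exchanged for `x`, which each round fixes.
  rw [← foldl_flatten_replicate, hM.foldl_update_eq _ _ x₀ x, foldl_flatten_replicate]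
  · exact iterate_fixed (by rw [AModule.foldl_inputTrace, hx]) _
  · simp only [List.length_flatten, List.map_replicate, List.sum_replicate, AModule.inputTrace,
      List.length_map, List.length_range, smul_eq_mul]
    exact Nat.le_mul_of_pos_right _ hc

end AutomataNet

namespace AutomataNet

open Function StackProg

/-! ### The stacks of the algorithm -/

/-- The names of the stacks. -/
inductive Stk : Type
  | inp | out
  | word | used
  | time | nodes | inputs | aux | auxIn
  | guess | guessUsed
  | cfg | inVals | newCfg | newIn | saved | tmp | tmpSaved
  | vals | cnt | letter
  | neq | eqs | found | go
  deriving DecidableEq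

instance : Fintype Stk where
  elems := {.inp, .out, .word, .used, .time, .nodes, .inputs, .aux, .auxIn, .guess, .guessUsed,
    .cfg, .inVals, .newCfg, .newIn, .saved, .tmp, .tmpSaved, .vals, .cnt, .letter, .neq, .eqs,
    .found, .go}
  complete k := by cases k <;> simp

/-- The alphabets of the stacks. -/
abbrev Sym (m : ℕ) : Stk → Type
  | .inp | .word | .used => Token
  | .out | .vals | .eqs => Bool
  | .guess | .guessUsed => Option (Fin (m + 1))
  | .cfg | .inVals | .newCfg | .newIn | .saved | .tmp | .tmpSaved => Fin (m + 1)
  | .time | .nodes | .inputs | .aux | .auxIn | .cnt | .letter | .neq | .found | .go => Unit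

instance (m : ℕ) (k : Stk) : Fintype (Sym m k) := by
  cases k <;> dsimp only [Sym] <;> infer_instance

/-- The contents of the stacks. -/
@[ext]
structure Store (m : ℕ) : Type where
  inp : List Token := []
  out : List Bool := []
  word : List Token := []
  used : List Token := []
  time : List Unit := []
  nodes : List Unit := []
  inputs : List Unit := []
  aux : List Unit := []
  auxIn : List Unit := []
  guess : List (Option (Fin (m + 1))) := []
  guessUsed : List (Option (Fin (m + 1))) := []
  cfg : List (Fin (m + 1)) := []
  inVals : List (Fin (m + 1)) := []
  newCfg : List (Fin (m + 1)) := []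
  newIn : List (Fin (m + 1)) := []
  saved : List (Fin (m + 1)) := []
  tmp : List (Fin (m + 1)) := []
  tmpSaved : List (Fin (m + 1)) := []
  vals : List Bool := []
  cnt : List Unit := []
  letter : List Unit := []
  neq : List Unit := []
  eqs : List Bool := []
  found : List Unit := []
  go : List Unit := []

namespace Store

variable {m : ℕ}

/-- The content of the stack of a given name. -/
def stk (s : Store m) : (k : Stk) → List (Sym m k)
  | .inp => s.inp
  | .out => s.out
  | .word => s.word
  | .used => s.used
  | .time => s.time
  | .nodes => s.nodes
  | .inputs => s.inputs
  | .aux => s.aux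
  | .auxIn => s.auxIn
  | .guess => s.guess
  | .guessUsed => s.guessUsed
  | .cfg => s.cfg
  | .inVals => s.inVals
  | .newCfg => s.newCfg
  | .newIn => s.newIn
  | .saved => s.saved
  | .tmp => s.tmp
  | .tmpSaved => s.tmpSaved
  | .vals => s.vals
  | .cnt => s.cnt
  | .letter => s.letter
  | .neq => s.neq
  | .eqs => s.eqs
  | .found => s.found
  | .go => s.go

/-- Replaces the content of one stack. -/
def set (s : Store m) : (k : Stk) → List (Sym m k) → Store m
  | .inp, l => { s with inp := l }
  | .out, l => { s with out := l }
  | .word, l => { s with word := l }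
  | .used, l => { s with used := l }
  | .time, l => { s with time := l }
  | .nodes, l => { s with nodes := l }
  | .inputs, l => { s with inputs := l }
  | .aux, l => { s with aux := l }
  | .auxIn, l => { s with auxIn := l }
  | .guess, l => { s with guess := l }
  | .guessUsed, l => { s with guessUsed := l }
  | .cfg, l => { s with cfg := l }
  | .inVals, l => { s with inVals := l }
  | .newCfg, l => { s with newCfg := l }
  | .newIn, l => { s with newIn := l }
  | .saved, l => { s with saved := l }
  | .tmp, l => { s with tmp := l }
  | .tmpSaved, l => { s with tmpSaved := l }
  | .vals, l => { s with vals := l }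
  | .cnt, l => { s with cnt := l }
  | .letter, l => { s with letter := l }
  | .neq, l => { s with neq := l }
  | .eqs, l => { s with eqs := l }
  | .found, l => { s with found := l }
  | .go, l => { s with go := l }

/-- Reduces equations between records to equations between the functions `stk`, where the lemmas on
`Function.update` apply. -/
theorem stk_injective : Injective (stk (m := m)) := by
  intro s s' h
  have h' := fun k => congrFun h k
  exact Store.ext (h' .inp) (h' .out) (h' .word) (h' .used) (h' .time) (h' .nodes) (h' .inputs)
    (h' .aux) (h' .auxIn) (h' .guess) (h' .guessUsed) (h' .cfg) (h' .inVals) (h' .newCfg)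
    (h' .newIn) (h' .saved) (h' .tmp) (h' .tmpSaved) (h' .vals) (h' .cnt) (h' .letter) (h' .neq)
    (h' .eqs) (h' .found) (h' .go)

theorem stk_set (s : Store m) (k : Stk) (l : List (Sym m k)) :
    (s.set k l).stk = update s.stk k l := by
  funext j
  cases k <;> cases j <;> rfl

@[simp]
theorem stk_set_self (s : Store m) (k : Stk) (l : List (Sym m k)) : (s.set k l).stk k = l := by
  rw [stk_set, update_self]

theorem stk_set_of_ne (s : Store m) {k j : Stk} (h : j ≠ k) (l : List (Sym m k)) :
    (s.set k l).stk j = s.stk j := by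
  rw [stk_set, update_of_ne h]

@[simp]
theorem set_set (s : Store m) (k : Stk) (l l' : List (Sym m k)) :
    (s.set k l).set k l' = s.set k l' :=
  stk_injective (by simp only [stk_set, update_idem])

theorem set_comm (s : Store m) {k j : Stk} (h : k ≠ j) (l : List (Sym m k)) (l' : List (Sym m j)) :
    (s.set k l).set j l' = (s.set j l').set k l :=
  stk_injective (by simp only [stk_set]; exact update_comm h _ _ _)

@[simp]
theorem set_stk (s : Store m) (k : Stk) : s.set k (s.stk k) = s :=
  stk_injective (by simp only [stk_set, update_eq_self])

end Store

/-! ### Executions within a time bound -/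

notation:40 p:41 " ⨾ " q:40 => StackProg.seq p q

variable {m : ℕ}

/-- Started on the store `s`, the program `p` ends on the store `s'` after at most `T` steps. -/
def Exec (p : StackProg (Sym m)) (s : Store m) (T : ℕ) (s' : Store m) : Prop :=
  ∃ t ≤ T, p.Run s.stk t s'.stk

namespace Exec

variable {p q : StackProg (Sym m)} {s s' s'' : Store m} {T T' : ℕ}

theorem mono (h : Exec p s T s') (hT : T ≤ T') : Exec p s T' s' :=
  let ⟨t, ht, hr⟩ := h
  ⟨t, ht.trans hT, hr⟩

theorem conv (h : Exec p s T s') (hT : T ≤ T') (hs : s' = s'') : Exec p s T' s'' :=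
  hs ▸ h.mono hT

theorem skip (s : Store m) : Exec skip s 1 s := ⟨1, le_rfl, .skip _⟩

theorem push (k : Stk) (x : Sym m k) (s : Store m) :
    Exec (push k x) s 1 (s.set k (x :: s.stk k)) :=
  ⟨1, le_rfl, by rw [Store.stk_set]; exact .push ..⟩

theorem seq (h : Exec p s T s') (h' : Exec q s' T' s'') : Exec (p ⨾ q) s (T + T') s'' :=
  let ⟨t, ht, hr⟩ := h
  let ⟨t', ht', hr'⟩ := h'
  ⟨t + t', add_le_add ht ht', .seq hr hr'⟩

theorem case_nil {k : Stk} {f : Option (Sym m k) → StackProg (Sym m)} (hs : s.stk k = [])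
    (h : Exec (f none) s T s') : Exec (case k f) s (1 + T) s' :=
  let ⟨t, ht, hr⟩ := h
  ⟨1 + t, by omega, .case_nil hs hr⟩

theorem case_cons {k : Stk} {f : Option (Sym m k) → StackProg (Sym m)} {x : Sym m k}
    {l : List (Sym m k)} (hs : s.stk k = x :: l) (h : Exec (f (some x)) (s.set k l) T s') :
    Exec (case k f) s (1 + T) s' :=
  let ⟨t, ht, hr⟩ := h
  ⟨1 + t, by omega, .case_cons hs (by rwa [Store.stk_set] at hr)⟩

theorem loop_nil {k : Stk} {f : Sym m k → StackProg (Sym m)} (hs : s.stk k = []) :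
    Exec (loop k f) s 1 s :=
  ⟨1, le_rfl, .loop_nil hs⟩

theorem loop_cons {k : Stk} {f : Sym m k → StackProg (Sym m)} {x : Sym m k}
    {l : List (Sym m k)} (hs : s.stk k = x :: l) (h : Exec (f x) (s.set k l) T s')
    (h' : Exec (loop k f) s' T' s'') : Exec (loop k f) s (1 + T + T') s'' :=
  let ⟨t, ht, hr⟩ := h
  let ⟨t', ht', hr'⟩ := h'
  ⟨1 + t + t', by omega, .loop_cons hs (by rwa [Store.stk_set] at hr) hr'⟩

end Exec

/-! ### Emptying, moving and counting -/

/-- Empties a stack. -/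
def clear (k : Stk) : StackProg (Sym m) := loop k fun _ => skip

theorem exec_clear (k : Stk) (s : Store m) :
    Exec (clear k) s (2 * (s.stk k).length + 1) (s.set k []) := by
  generalize hl : s.stk k = l
  induction l generalizing s with
  | nil => exact (Exec.loop_nil hl).conv (by simp) (by rw [← hl, Store.set_stk])
  | cons x l ih =>
    exact (Exec.loop_cons hl (Exec.skip _) (ih (s.set k l) (by simp))).conv
      (by simp; omega) (by simp)

/-- Moves the content of one stack to another, reversing it. -/
def move (a b : Stk) (g : Sym m a → Sym m b) : StackProg (Sym m) := loop a fun x => push b (g x)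

theorem exec_move {a b : Stk} (hab : a ≠ b) (g : Sym m a → Sym m b) (s : Store m) :
    Exec (move a b g) s (2 * (s.stk a).length + 1)
      ((s.set a []).set b ((s.stk a).reverse.map g ++ s.stk b)) := by
  generalize hl : s.stk a = l
  induction l generalizing s with
  | nil =>
    refine (Exec.loop_nil hl).conv (by simp) ?_
    rw [← hl, Store.set_stk, hl, List.reverse_nil, List.map_nil, List.nil_append, Store.set_stk]
  | cons x l ih =>
    refine (Exec.loop_cons hl (Exec.push b (g x) _) (ih _ ?_)).conv (by simp; omega) ?_
    · rw [Store.stk_set_of_ne _ hab, Store.stk_set_self]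
    · rw [Store.set_comm _ hab.symm, Store.set_set, Store.set_set, Store.stk_set_self,
        Store.stk_set_of_ne _ hab.symm]
      simp

/-- Runs a program once for each symbol of the stack `a`, which is restored afterwards by means of
the stack `b`. -/
def forEach (a : Stk) (x : Sym m a) (b : Stk) (y : Sym m b) (p : StackProg (Sym m)) :
    StackProg (Sym m) :=
  loop a (fun _ => push b y ⨾ p) ⨾ move b a fun _ => x

/-- Here `st i` is the store after `i` rounds. The hypothesis allows any contents of `a` and `b`, as
these vary during the loop. Besides `T`, each round costs a pop and a push, and two more steps when
its symbol is moved back. -/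
theorem exec_forEach {a b : Stk} (hab : a ≠ b) (x : Sym m a) (y : Sym m b)
    {p : StackProg (Sym m)} {T : ℕ} (st : ℕ → Store m) (N : ℕ)
    (h : ∀ i < N, ∀ l l', Exec p (((st i).set a l).set b l') T (((st (i + 1)).set a l).set b l')) :
    Exec (forEach a x b y p) (((st 0).set a (List.replicate N x)).set b []) (N * (T + 4) + 2)
      (((st N).set a (List.replicate N x)).set b []) := by
  have key : ∀ j ≤ N, ∀ l', Exec (loop a (fun _ => push b y ⨾ p))
      (((st (N - j)).set a (List.replicate j x)).set b l') (j * (T + 2) + 1)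
      (((st N).set a []).set b (List.replicate j y ++ l')) := by
    intro j
    induction j with
    | zero =>
      intro _ l'
      exact (Exec.loop_nil (by rw [Store.stk_set_of_ne _ hab]; simp)).mono (by simp)
    | succ j ih =>
      intro hj l'
      have h1 := h (N - (j + 1)) (by omega) (List.replicate j x) (y :: l')
      rw [show N - (j + 1) + 1 = N - j by omega] at h1
      have h0 := Exec.push b y (((st (N - (j + 1))).set a (List.replicate j x)).set b l')
      rw [Store.stk_set_self, Store.set_set] at h0
      have h01 := Exec.seq h0 h1
      rw [← Store.set_set (st (N - (j + 1))) a (List.replicate (j + 1) x) (List.replicate j x),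
        Store.set_comm _ hab] at h01
      refine (Exec.loop_cons (x := x) (l := List.replicate j x)
        (by rw [Store.stk_set_of_ne _ hab, Store.stk_set_self, List.replicate_succ]) h01
        (ih (by omega) (y :: l'))).conv (by ring_nf; omega) ?_
      rw [List.replicate_succ', List.append_assoc]
      rfl
  refine (Exec.seq ((Nat.sub_self N) ▸ key N le_rfl [])
    (exec_move hab.symm (fun _ => x) _)).conv ?_ ?_
  · simp
    ring_nf
    omega
  · rw [Store.set_set, Store.set_comm _ hab.symm, Store.set_set, Store.stk_set_self,
      Store.stk_set_of_ne _ hab, Store.stk_set_self]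
    simp

end AutomataNet

namespace AutomataNet

open Function StackProg

variable {m : ℕ}

/-! ### Evaluating a module -/

/-- Pops from the stack `letter` a number that is smaller than `fuel`, and continues with it. -/
def readLetter : (fuel a : ℕ) → (ℕ → StackProg (Sym m)) → StackProg (Sym m)
  | 0, a, p => p a
  | fuel + 1, a, p => case .letter fun o => o.elim (p a) fun _ => readLetter fuel (a + 1) p

/-- The number passes from the stack into the control of the program, which is a finite tree because
of the fuel. The `i + 1` steps include the pop that finds the stack empty. -/
theorem exec_readLetter (p : ℕ → StackProg (Sym m)) {s s' : Store m} {T : ℕ} (i fuel a : ℕ)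
    (hi : i < fuel) (h : Exec (p (a + i)) { s with letter := [] } T s') :
    Exec (readLetter fuel a p) { s with letter := List.replicate i () } (i + 1 + T) s' := by
  induction i generalizing fuel a with
  | zero =>
    obtain ⟨fuel, rfl⟩ := Nat.exists_eq_succ_of_ne_zero hi.ne'
    exact (Exec.case_nil rfl h).mono (by omega)
  | succ i ih =>
    obtain ⟨fuel, rfl⟩ := Nat.exists_eq_succ_of_ne_zero (Nat.ne_zero_of_lt hi)
    exact (Exec.case_cons (k := .letter) rfl
      (ih fuel (a + 1) (by omega) (by rwa [add_right_comm, add_assoc]))).mono (by omega)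

/-- Continues with the symbol of the stack `k` whose index is on the stack `cnt`. -/
def lookup (k : Stk) (g : Sym m k → Fin (m + 1)) (g' : Fin (m + 1) → Sym m k)
    (p : Fin (m + 1) → StackProg (Sym m)) : StackProg (Sym m) :=
  loop .cnt (fun _ => case k fun o => o.elim skip fun x => push .tmp (g x)) ⨾
  case k fun o => o.elim skip fun x => push k x ⨾ move .tmp k g' ⨾ p (g x)

/-- Each of the `i` symbols above the wanted one costs three steps on the way to `tmp` and two on
the way back. -/
theorem exec_lookup {k : Stk} (hk : k ≠ .tmp) (hk' : k ≠ .cnt) (g : Sym m k → Fin (m + 1))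
    (g' : Fin (m + 1) → Sym m k) (hg : ∀ x, g' (g x) = x) (p : Fin (m + 1) → StackProg (Sym m))
    (s s' : Store m) {T : ℕ} {l : List (Sym m k)} {i : ℕ} {x : Sym m k} (hx : l[i]? = some x)
    (h : Exec (p (g x)) (((s.set k l).set .tmp []).set .cnt []) T s') :
    Exec (lookup k g g' p) (((s.set k l).set .tmp []).set .cnt (List.replicate i ()))
      (5 * i + 4 + T) s' := by
  -- As `k` is a variable, its updates do not compute; the needed commutations are collected for
  -- this normal form.
  let st (l : List (Sym m k)) (t : List (Fin (m + 1))) (c : List Unit) : Store m :=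
    ((s.set k l).set .tmp t).set .cnt c
  have stk_k (l t c) : (st l t c).stk k = l := by
    simp only [st]; rw [Store.stk_set_of_ne _ hk', Store.stk_set_of_ne _ hk, Store.stk_set_self]
  have set_k (l t c l') : (st l t c).set k l' = st l' t c := by
    simp only [st]
    rw [Store.set_comm _ hk'.symm, Store.set_comm _ hk.symm, Store.set_set]
  have set_tmp (l t c t') : (st l t c).set .tmp t' = st l t' c := rfl
  have loop_eq : ∀ (i : ℕ) (l : List (Sym m k)) (t : List (Fin (m + 1))), i ≤ l.length →
      Exec (loop .cnt (fun _ => case k fun o => o.elim skip fun x => push .tmp (g x)))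
        (st l t (List.replicate i ())) (3 * i + 1) (st (l.drop i) ((l.take i).reverse.map g ++ t) []) := by
    intro i
    induction i with
    | zero => intro l t _; exact Exec.loop_nil rfl
    | succ i ih =>
      intro l t hi
      obtain _ | ⟨y, l⟩ := l
      · simp at hi
      · have h1 := ih l (g y :: t) (by simpa using hi)
        have h2 := Exec.push .tmp (g y) (st l t (List.replicate i ()))
        refine (Exec.loop_cons (k := .cnt) (x := ()) (l := List.replicate i ()) rfl
          (Exec.case_cons (T := 1) (k := k) (x := y) (l := l) (stk_k _ _ _) ?_) h1).conv ?_ ?_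
        · exact h2.conv le_rfl rfl |> (by
            have := set_k (y :: l) t (List.replicate i ()) l
            simp only [st] at this ⊢
            exact this ▸ ·)
        · omega
        · simp
  obtain ⟨hi, rfl⟩ := List.getElem?_eq_some_iff.1 hx
  have h1 := loop_eq i l [] hi.le
  rw [List.drop_eq_getElem_cons hi] at h1
  have h2 := Exec.push k l[i] (st (l.drop (i + 1)) ((l.take i).reverse.map g ++ []) [])
  rw [stk_k, set_k] at h2
  have h3 := exec_move hk.symm g' (st (l[i] :: l.drop (i + 1)) ((l.take i).reverse.map g ++ []) [])
  rw [set_tmp, set_k, stk_k] at h3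
  have e : (((st (l[i] :: l.drop (i + 1)) ((l.take i).reverse.map g ++ []) []).stk .tmp).reverse.map
      g' ++ l[i] :: l.drop (i + 1)) = l := by
    change (List.map g' (List.reverse ((l.take i).reverse.map g ++ [])) ++ _) = l
    rw [← List.drop_eq_getElem_cons hi]
    simp [hg, Function.comp_def]
  rw [e] at h3
  refine (Exec.seq h1 (Exec.case_cons (T := 1 + (2 * i + 1 + T)) (stk_k _ _ _) ?_)).mono ?_
  · rw [set_k]
    refine (Exec.seq h2 (Exec.seq (h3.mono ?_) h)).mono le_rfl
    change 2 * List.length ((l.take i).reverse.map g ++ []) + 1 ≤ 2 * i + 1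
    simp
  · omega

/-- Pops one truth value for each index in the list, and pushes on `newCfg` the largest of `x` and
the letters of the indices with the value `true`. -/
def pickLetter : List (Fin m) → Fin (m + 1) → StackProg (Sym m)
  | [], x => push .newCfg x
  | a :: l, x => case .vals fun o =>
      if (o.getD false : Bool) then pickLetter l (x ⊔ a.succ) else pickLetter l x

theorem exec_pickLetter (b : Fin m → Bool) (l : List (Fin m)) (x : Fin (m + 1)) (s : Store m)
    (bs : List Bool) :
    Exec (pickLetter l x) { s with vals := l.map b ++ bs } (l.length + 1)
      { s with
        vals := bs
        newCfg := (x ⊔ (l.toFinset.filter fun a => b a = true).sup Fin.succ) :: s.newCfg } := by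
  induction l generalizing x with
  | nil => exact (Exec.push _ _ _).conv le_rfl (by simp; rfl)
  | cons a l ih =>
    rcases hb : b a
    · refine (Exec.case_cons (T := l.length + 1) (k := .vals) (x := b a) (l := l.map b ++ bs) rfl ?_).conv ?_ rfl
      · rw [if_neg (by simp [hb])]
        refine (ih x).conv le_rfl ?_
        simp [Finset.filter_insert, hb]
      · simp; omega
    · refine (Exec.case_cons (T := l.length + 1) (k := .vals) (x := b a) (l := l.map b ++ bs) rfl ?_).conv ?_ rfl
      · rw [if_pos (by simp [hb])]
        refine (ih _).conv le_rfl ?_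
        simp [Finset.filter_insert, hb, sup_assoc]
      · simp; omega

/-- The action of the evaluation on a symbol of the code of a module, which is read backwards. -/
def scanToken : Token → StackProg (Sym m)
  | .tick => push .cnt ()
  -- Backwards, the end mark comes before the ticks of its number. In an atom, the mark of the node
  -- or input number thus finds the letter number in `cnt` and moves it away.
  | .sep => move .cnt .letter id
  -- The wiring precedes the nodes in the word, so backwards it is met when `newCfg` is already
  -- complete.
  | .wireMark => lookup .newCfg id id fun x => push .newIn x
  | .nodeMark => pickLetter (List.finRange m) 0
  | .formulaMark => skip
  -- The index `a` stands for the letter `a + 1`.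
  | .nodeAtom => readLetter m 0 fun a =>
      lookup .cfg id id fun x => push .vals (decide ((x : ℕ) = a + 1))
  | .inputAtom => readLetter m 0 fun a =>
      lookup .inVals id id fun x => push .vals (decide ((x : ℕ) = a + 1))
  | .tru => push .vals true
  | .fls => push .vals false
  | .neg => case .vals fun o => push .vals (!(o.getD false : Bool))
  | .and => case .vals fun o => case .vals fun o' =>
      push .vals ((o.getD false : Bool) && (o'.getD false : Bool))
  | .or => case .vals fun o => case .vals fun o' =>
      push .vals ((o.getD false : Bool) || (o'.getD false : Bool))

/-- The loop that reads the code of a module backwards. -/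
def scanLoop : StackProg (Sym m) := loop .word fun t => push .used t ⨾ scanToken t

/-! ### Correctness and cost of the backward evaluation -/

/-- Reading the word `l` backwards leads from `s` to `s'`, with at most `D` steps for each
symbol. -/
def Scans (D : ℕ) (l : List Token) (s s' : Store m) : Prop :=
  ∀ rest used T s'', Exec scanLoop { s' with word := rest, used := l ++ used } T s'' →
    Exec scanLoop { s with word := l.reverse ++ rest, used := used } (l.length * D + T) s''

namespace Scans

variable {D : ℕ} {s s' s'' : Store m}

theorem nil (s : Store m) : Scans D [] s s := by
  intro rest used T s'' h
  simpa using h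

/-- The right part is read first. Since `Scans` is phrased through an arbitrary continuation of the
loop, the two parts compose directly. -/
theorem append {l l' : List Token} (h' : Scans D l' s s') (h : Scans D l s' s'') :
    Scans D (l ++ l') s s'' := by
  intro rest used T r hr
  rw [List.append_assoc] at hr
  have := h' _ _ _ _ (h _ _ _ _ hr)
  rw [← List.append_assoc, ← List.reverse_append] at this
  exact this.mono (by rw [List.length_append, Nat.add_mul]; omega)

theorem token {t : Token} {T : ℕ} (hT : T + 2 ≤ D)
    (h : ∀ w u, Exec (scanToken t) { s with word := w, used := u } T
      { s' with word := w, used := u }) : Scans D [t] s s' := by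
  intro rest used T' r hr
  have h1 := Exec.seq (Exec.push .used t { s with word := rest, used := used }) (h rest (t :: used))
  exact (Exec.loop_cons (k := .word) (x := t) (l := rest) rfl h1 hr).mono (by simp; omega)

theorem cons {t : Token} {l : List Token} {T : ℕ} (h' : Scans D l s s') (hT : T + 2 ≤ D)
    (h : ∀ w u, Exec (scanToken t) { s' with word := w, used := u } T
      { s'' with word := w, used := u }) : Scans D (t :: l) s s'' :=
  append h' (token hT h)

theorem congr_right {l : List Token} (h : Scans D l s s') (hs : s' = s'') : Scans D l s s'' :=
  hs ▸ h

theorem ticks (hD : 3 ≤ D) (a : ℕ) (s : Store m) :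
    Scans D (List.replicate a .tick) s { s with cnt := List.replicate a () ++ s.cnt } := by
  induction a with
  | zero => exact nil _
  | succ a ih =>
    rw [List.replicate_succ]
    exact cons ih (T := 1) hD fun w u => Exec.push .cnt () _

theorem num (a : ℕ) (s : Store m) (hD : 2 * s.cnt.length + 3 ≤ D) :
    Scans D (encodeNum a) s
      { s with letter := s.cnt.reverse ++ s.letter, cnt := List.replicate a () } := by
  refine append (s' := { s with letter := s.cnt.reverse ++ s.letter, cnt := [] })
    (token (T := 2 * s.cnt.length + 1) (by omega) fun w u => ?_)
    ((ticks (by omega) a _).congr_right (by simp))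
  exact (exec_move (a := .cnt) (b := .letter) (by decide) id _).conv le_rfl (by
    rw [List.map_id]
    rfl)

variable {n k : ℕ} (x : Fin n → Fin (m + 1)) (v : Fin k → Fin (m + 1))

/-- A store in which the configuration `x` and the input letters `v` are ready to be read, and `bs`
is the stack of truth values. -/
def reading (s : Store m) (bs : List Bool) : Store m :=
  { s with
    cfg := List.ofFn x, inVals := List.ofFn v, cnt := [], letter := [], tmp := [], vals := bs }

/-- The bound on `D` serves for all tokens: a lookup at index `i` costs `5 * i + 4`, reading or
moving a letter number at most about `2 * m`, and every token is popped and saved on `used`. -/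
theorem atom (hD : 5 * (n + k) + 2 * m + 10 ≤ D) (p : (Fin n ⊕ Fin k) × Fin m) (s : Store m)
    (bs : List Bool) :
    Scans D (encodeAtom p) (reading x v s bs)
      (reading x v s (decide (Sum.elim x v p.1 = p.2.succ) :: bs)) := by
  have dec (y : Fin (m + 1)) (a : Fin m) :
      decide ((y : ℕ) = 0 + (a : ℕ) + 1) = decide (y = a.succ) := by
    simp [Fin.ext_iff]
  obtain ⟨i | i, a⟩ := p
  all_goals
    have ha := a.2
    have hi := i.2
  · refine cons (append (num a _ (by simp [reading]; omega)) (num i _ (by simp; omega)))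
      (T := a + 1 + (5 * i + 4 + 1)) (by omega) fun w u => ?_
    have h := exec_lookup (k := .cfg) (by decide) (by decide) id id (fun _ => rfl)
      (fun y => push .vals (decide ((y : ℕ) = 0 + a + 1)))
      { reading x v s bs with word := w, used := u } _ (l := List.ofFn x) (i := i) (x := x i)
      (by simp) (Exec.push ..)
    refine (exec_readLetter (s := { reading x v s bs with
      cnt := List.replicate i (), word := w, used := u }) _ a m 0 ha h).conv le_rfl ?_ |> (by
        simpa [reading, scanToken] using ·)
    rw [id, dec]
    rfl
  · refine cons (append (num a _ (by simp [reading]; omega)) (num i _ (by simp; omega)))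
      (T := a + 1 + (5 * i + 4 + 1)) (by omega) fun w u => ?_
    have h := exec_lookup (k := .inVals) (by decide) (by decide) id id (fun _ => rfl)
      (fun y => push .vals (decide ((y : ℕ) = 0 + a + 1)))
      { reading x v s bs with word := w, used := u } _ (l := List.ofFn v) (i := i) (x := v i)
      (by simp) (Exec.push ..)
    refine (exec_readLetter (s := { reading x v s bs with
      cnt := List.replicate i (), word := w, used := u }) _ a m 0 ha h).conv le_rfl ?_ |> (by
        simpa [reading, scanToken] using ·)
    rw [id, dec]
    rfl

/-- Prefix notation read backwards is postfix notation: the values of the arguments are on the stack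
when the connective is met, that of `φ` above that of `ψ`. -/
theorem formula (hD : 5 * (n + k) + 2 * m + 10 ≤ D) (φ : Formula ((Fin n ⊕ Fin k) × Fin m))
    (s : Store m) (bs : List Bool) :
    Scans D (encodeFormula φ) (reading x v s bs)
      (reading x v s (φ.eval (fun p => decide (Sum.elim x v p.1 = p.2.succ)) :: bs)) := by
  induction φ generalizing bs with
  | tru => exact token (T := 1) (by omega) fun w u => Exec.push .vals _ _
  | fls => exact token (T := 1) (by omega) fun w u => Exec.push .vals _ _
  | atom p => exact atom x v hD p s bs
  | neg φ ih =>
    exact cons (ih bs) (T := 2) (by omega) fun w u =>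
      Exec.case_cons (T := 1) (k := .vals) rfl (Exec.push .vals _ _)
  | and φ ψ ihφ ihψ =>
    exact cons (append (ihψ bs) (ihφ _)) (T := 3) (by omega) fun w u =>
      Exec.case_cons (T := 2) (k := .vals) rfl
        (Exec.case_cons (T := 1) (k := .vals) rfl (Exec.push .vals _ _))
  | or φ ψ ihφ ihψ =>
    exact cons (append (ihψ bs) (ihφ _)) (T := 3) (by omega) fun w u =>
      Exec.case_cons (T := 2) (k := .vals) rfl
        (Exec.case_cons (T := 1) (k := .vals) rfl (Exec.push .vals _ _))

theorem formulas (hD : 5 * (n + k) + 2 * m + 10 ≤ D)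
    (φ : Fin m → Formula ((Fin n ⊕ Fin k) × Fin m)) (l : List (Fin m)) (s : Store m)
    (bs : List Bool) :
    Scans D (l.map fun a => Token.formulaMark :: encodeFormula (φ a)).flatten (reading x v s bs)
      (reading x v s
        ((l.map fun a => (φ a).eval (fun p => decide (Sum.elim x v p.1 = p.2.succ))) ++ bs)) := by
  induction l with
  | nil => exact nil _
  | cons a l ih =>
    exact append ih (cons (formula x v hD (φ a) s _) (T := 1) (by omega) fun w u => Exec.skip _)

theorem node (hD : 5 * (n + k) + 2 * m + 10 ≤ D) (P : ModuleCode m n k) (i : Fin n)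
    (s : Store m) :
    Scans D (Token.nodeMark ::
        (List.ofFn fun a => Token.formulaMark :: encodeFormula (P i a)).flatten)
      (reading x v s []) (reading x v { s with newCfg := P.toModule.update x v i :: s.newCfg } []) := by
  rw [List.ofFn_eq_map]
  refine cons (formulas x v hD (P i) _ s []) (T := m + 1) (by omega) fun w u => ?_
  refine (exec_pickLetter _ _ _ { reading x v s [] with word := w, used := u } []).conv ?_ ?_
  · simp
  · simp only [List.toFinset_finRange]
    -- The starting letter `0` is the default of `ModuleCode.toModule`, the supremum of the empty
    -- set.
    rw [show (0 : Fin (m + 1)) = ⊥ from rfl, bot_sup_eq]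
    rfl

theorem nodes (hD : 5 * (n + k) + 2 * m + 10 ≤ D) (P : ModuleCode m n k) (l : List (Fin n))
    (s : Store m) :
    Scans D (l.map fun i => Token.nodeMark ::
        (List.ofFn fun a => Token.formulaMark :: encodeFormula (P i a)).flatten).flatten
      (reading x v s [])
      (reading x v { s with newCfg := l.map (P.toModule.update x v) ++ s.newCfg } []) := by
  induction l with
  | nil => exact nil _
  | cons i l ih => exact append ih (node x v hD P i _)

theorem wires (hD : 5 * (n + k) + 2 * m + 10 ≤ D) (ω : Fin k → Fin n) (l : List (Fin k))
    (s : Store m) :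
    Scans D (l.map fun α => Token.wireMark :: encodeNum (ω α)).flatten
      { s with newCfg := List.ofFn x, cnt := [], letter := [], tmp := [] }
      { s with
        newCfg := List.ofFn x, newIn := l.map (x ∘ ω) ++ s.newIn
        cnt := [], letter := [], tmp := [] } := by
  induction l with
  | nil => exact nil _
  | cons α l ih =>
    have hα := (ω α).2
    refine append ih (cons (num (ω α) _ (by simp; omega)) (T := 5 * ω α + 4 + 1) (by omega)
      fun w u => ?_)
    exact exec_lookup (k := .newCfg) (by decide) (by decide) id id (fun _ => rfl)
      (fun y => push .newIn y)
      { s with newIn := l.map (x ∘ ω) ++ s.newIn, letter := [], word := w, used := u } _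
      (l := List.ofFn x) (i := ω α) (x := x (ω α)) (by simp) (Exec.push ..)

end Scans

/-- The part of the code of an instance that describes the module and its wiring. -/
def moduleWord {n k : ℕ} (P : ModuleCode m n k) (ω : Fin k → Fin n) : List Token :=
  (List.ofFn fun α => Token.wireMark :: encodeNum (ω α)).flatten
  ++ (List.ofFn fun s => Token.nodeMark ::
      (List.ofFn fun a => Token.formulaMark :: encodeFormula (P s a)).flatten).flatten

/-- Replaces the configuration by its update under the current input letters, and computes the input
letters that are wired to the new configuration. -/
def updateProg : StackProg (Sym m) :=
  scanLoop ⨾ move .used .word id ⨾ clear .cfg ⨾ clear .inVals ⨾ move .newCfg .tmp id ⨾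
    move .tmp .cfg id

theorem exec_updateProg {n k : ℕ} (P : ModuleCode m n k) (ω : Fin k → Fin n)
    (x : Fin n → Fin (m + 1)) (v : Fin k → Fin (m + 1)) (s : Store m) :
    Exec updateProg
      { s with
        word := (moduleWord P ω).reverse, used := [], cfg := List.ofFn x, inVals := List.ofFn v
        newCfg := [], newIn := [], tmp := [], cnt := [], letter := [], vals := [] }
      ((moduleWord P ω).length * (5 * (n + k) + 2 * m + 12) + 6 * (n + k) + 6)
      { s with
        word := (moduleWord P ω).reverse, used := [], cfg := List.ofFn (P.toModule.update x v)
        inVals := [], newCfg := [], newIn := List.ofFn (P.toModule.update x v ∘ ω), tmp := []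
        cnt := [], letter := [], vals := [] } := by
  have h1 := (Scans.nodes x v le_rfl P (List.finRange n) { s with newCfg := [], newIn := [] })
  have h2 := (Scans.wires (D := 5 * (n + k) + 2 * m + 10) (k := k) (P.toModule.update x v) le_rfl
    ω (List.finRange k) (Scans.reading x v { s with newIn := [] } []))
  rw [← List.ofFn_eq_map, ← List.ofFn_eq_map, List.append_nil] at h1
  rw [← List.ofFn_eq_map, ← List.ofFn_eq_map] at h2
  -- Nodes are scanned before wires, and the wires are read against the updated configuration.
  have h3 := Scans.append h1 h2 [] [] 1 _ (Exec.loop_nil rfl)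
  rw [List.append_nil] at h3
  refine (Exec.seq h3 <| Exec.seq (exec_move (a := .used) (b := .word) (by decide) id _) <|
    Exec.seq (exec_clear .cfg _) <| Exec.seq (exec_clear .inVals _) <|
    Exec.seq (exec_move (a := .newCfg) (b := .tmp) (by decide) id _)
      (exec_move (a := .tmp) (b := .cfg) (by decide) id _)).conv ?_ ?_
  · simp [Store.stk, Store.set, Scans.reading, moduleWord]
    ring_nf
    omega
  · simp [Store.stk, Store.set, Scans.reading, moduleWord]

end AutomataNet

namespace AutomataNet

open Function StackProg

variable {m n k : ℕ}

/-! ### Simulating a wired module -/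

/-- A bound for the number of steps of `updateProg`. -/
def updateTime (m n k L : ℕ) : ℕ := L * (5 * (n + k) + 2 * m + 12) + 6 * (n + k) + 6

/-- The store between two updates, with the configuration `x`. -/
def ready (P : ModuleCode m n k) (ω : Fin k → Fin n) (x : Fin n → Fin (m + 1)) (s : Store m) :
    Store m :=
  { s with
    word := (moduleWord P ω).reverse, used := [], cfg := List.ofFn x, inVals := []
    newCfg := [], newIn := List.ofFn (x ∘ ω), tmp := [], cnt := [], letter := [], vals := [] }

/-- Code of a sequence of input letters. -/
def encodeGuess (vs : List (Fin k → Fin (m + 1))) : List (Option (Fin (m + 1))) :=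
  -- Letters are reversed because pushing them on `inVals` reverses them again; `none` triggers an
  -- update.
  vs.flatMap fun v => (List.ofFn v).reverse.map some ++ [none]

theorem length_encodeGuess (vs : List (Fin k → Fin (m + 1))) :
    (encodeGuess vs).length = vs.length * (k + 1) := by
  simp [encodeGuess, List.length_flatMap]

/-- The loop of `feedProg`. -/
def feedLoop : StackProg (Sym m) :=
  loop .guess fun o => push .guessUsed o ⨾
    -- The letters supplied by the wiring are discarded, as the guessed ones replace them.
    o.elim (clear .newIn ⨾ updateProg) fun a => push .inVals a

theorem exec_feedLoop_letters (l : List (Fin (m + 1))) (rest gu : List (Option (Fin (m + 1))))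
    (iv : List (Fin (m + 1))) (s s' : Store m) (T : ℕ)
    (h : Exec feedLoop { s with
      guess := rest, guessUsed := (l.map some).reverse ++ gu, inVals := l.reverse ++ iv } T s') :
    Exec feedLoop { s with guess := l.map some ++ rest, guessUsed := gu, inVals := iv }
      (3 * l.length + T) s' := by
  induction l generalizing gu iv with
  | nil => simpa using h
  | cons a l ih =>
    refine (Exec.loop_cons (k := .guess) (x := some a) (l := l.map some ++ rest) rfl
      (Exec.seq (Exec.push .guessUsed (some a) _) (Exec.push .inVals a _))
      (ih (some a :: gu) (a :: iv) (by simpa using h))).mono ?_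
    simp
    omega

theorem exec_feedLoop (P : ModuleCode m n k) (ω : Fin k → Fin n)
    (vs : List (Fin k → Fin (m + 1))) (x : Fin n → Fin (m + 1))
    (gu : List (Option (Fin (m + 1)))) (s : Store m) :
    Exec feedLoop (ready P ω x { s with guess := encodeGuess vs, guessUsed := gu })
      (vs.length * (5 * k + updateTime m n k (moduleWord P ω).length + 3) + 1)
      (ready P ω (vs.foldl P.toModule.update x)
        { s with guess := [], guessUsed := (encodeGuess vs).reverse ++ gu }) := by
  induction vs generalizing x gu with
  | nil => exact (Exec.loop_nil rfl).mono (by simp)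
  | cons v vs ih =>
    have h1 := ih (P.toModule.update x v) (none :: ((List.ofFn v).reverse.map some).reverse ++ gu)
    have h2 := exec_updateProg P ω x v (ready P ω x { s with
      guess := encodeGuess vs
      guessUsed := none :: ((List.ofFn v).reverse.map some).reverse ++ gu })
    have h3 := exec_feedLoop_letters (List.ofFn v).reverse (none :: encodeGuess vs) gu []
      (ready P ω x s) _ _ (Exec.loop_cons (k := .guess) (x := none) (l := encodeGuess vs) rfl
        (Exec.seq (Exec.push .guessUsed none _) (Exec.seq (exec_clear .newIn _)
          (by rw [List.reverse_reverse, List.append_nil]; exact h2))) h1)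
    have e : encodeGuess (v :: vs) = (List.ofFn v).reverse.map some ++ none :: encodeGuess vs := by
      simp [encodeGuess]
    rw [e]
    refine h3.conv ?_ ?_
    · simp only [updateTime, Store.stk, Store.set, ready, List.length_reverse, List.length_ofFn,
        List.length_cons]
      ring_nf
      omega
    · simp

/-- Feeds the sequence of input letters to the module. -/
def feedProg : StackProg (Sym m) := feedLoop ⨾ move .guessUsed .guess id

theorem exec_feedProg (P : ModuleCode m n k) (ω : Fin k → Fin n)
    (vs : List (Fin k → Fin (m + 1))) (x : Fin n → Fin (m + 1)) (s : Store m) :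
    Exec feedProg (ready P ω x { s with guess := encodeGuess vs, guessUsed := [] })
      (vs.length * (7 * k + updateTime m n k (moduleWord P ω).length + 5) + 2)
      (ready P ω (vs.foldl P.toModule.update x)
        { s with guess := encodeGuess vs, guessUsed := [] }) := by
  refine (Exec.seq (exec_feedLoop P ω vs x [] s)
    (exec_move (a := .guessUsed) (b := .guess) (by decide) id _)).conv ?_ ?_
  · simp only [ready, Store.stk, List.append_nil, List.length_reverse, length_encodeGuess]
    ring_nf
    omega
  · simp [ready, Store.stk, Store.set]

/-- One step of the wired module. -/
def stepProg : StackProg (Sym m) := move .newIn .tmp id ⨾ move .tmp .inVals id ⨾ updateProg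

theorem exec_stepProg (P : ModuleCode m n k) (ω : Fin k → Fin n) (x : Fin n → Fin (m + 1))
    (s : Store m) :
    Exec stepProg (ready P ω x s) (4 * k + 2 + updateTime m n k (moduleWord P ω).length)
      (ready P ω ((P.toModule.wire ω).update x) s) := by
  have h := exec_updateProg P ω x (x ∘ ω) (ready P ω x s)
  rw [← AModule.wire_update] at h
  have h1 := exec_move (a := .newIn) (b := .tmp) (by decide) id (ready P ω x s)
  refine (Exec.seq h1 (Exec.seq (exec_move (a := .tmp) (b := .inVals) (by decide) id _)
    (T' := updateTime m n k (moduleWord P ω).length) ?_)).conv ?_ rfl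
  · simpa [ready, Store.stk, Store.set, updateTime] using h
  · simp [ready, Store.stk, Store.set]
    omega

/-- Records on the stack `eqs` whether the configuration is the saved one. -/
def compareProg : StackProg (Sym m) :=
  loop .cfg (fun x => push .tmp x ⨾ case .saved fun o => o.elim skip fun y =>
    push .tmpSaved y ⨾ if x = y then skip else push .neq ()) ⨾
  move .tmp .cfg id ⨾ move .tmpSaved .saved id ⨾
  case .neq fun o => o.elim (push .eqs true) fun _ => clear .neq ⨾ push .eqs false

/-- Only the emptiness of `neq` matters for the answer; its length is bounded for the cost of
clearing it. -/
theorem exec_compareProg_loop (l l' t t' : List (Fin (m + 1))) (hl : l.length = l'.length)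
    (q : List Unit) (s : Store m) :
    ∃ q', (q' = [] ↔ q = [] ∧ l = l') ∧ q'.length ≤ q.length + l.length ∧
      Exec (loop .cfg (fun x => push .tmp x ⨾ case .saved fun o => o.elim skip fun y =>
          push .tmpSaved y ⨾ if x = y then skip else push .neq ()))
        { s with cfg := l, saved := l', tmp := t, tmpSaved := t', neq := q } (5 * l.length + 1)
        { s with
          cfg := [], saved := [], tmp := l.reverse ++ t, tmpSaved := l'.reverse ++ t', neq := q' } := by
  induction l generalizing l' t t' q with
  | nil =>
    obtain rfl : l' = [] := List.length_eq_zero_iff.1 hl.symm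
    exact ⟨q, by simp, by simp, Exec.loop_nil rfl⟩
  | cons x l ih =>
    obtain _ | ⟨y, l'⟩ := l'
    · simp at hl
    obtain ⟨q', h1, h2, h3⟩ := ih l' (x :: t) (y :: t') (by simpa using hl)
      (if x = y then q else () :: q)
    refine ⟨q', ?_, ?_, ?_⟩
    · rw [h1]
      split_ifs with h <;> simp [h]
    · refine h2.trans ?_
      split_ifs <;> simp
      omega
    · have h4 : Exec (if x = y then skip else push .neq ())
          { s with cfg := l, saved := l', tmp := x :: t, tmpSaved := y :: t', neq := q } 1
          { s with
            cfg := l, saved := l', tmp := x :: t, tmpSaved := y :: t'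
            neq := if x = y then q else () :: q } := by
        split_ifs
        · exact Exec.skip _
        · exact Exec.push .neq () _
      refine (Exec.loop_cons (k := .cfg) (x := x) (l := l) rfl
        (Exec.seq (Exec.push .tmp x _) (Exec.case_cons (k := .saved) (x := y) (l := l') rfl
          (Exec.seq (Exec.push .tmpSaved y _) h4))) h3).conv ?_ ?_
      · simp
        omega
      · simp

theorem exec_compareProg (l l' : List (Fin (m + 1))) (hl : l.length = l'.length) (s : Store m) :
    Exec compareProg { s with cfg := l, saved := l', tmp := [], tmpSaved := [], neq := [] }
      (11 * l.length + 6)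
      { s with
        cfg := l, saved := l', tmp := [], tmpSaved := [], neq := [], eqs := decide (l = l') :: s.eqs } := by
  obtain ⟨q, h1, h2, h3⟩ := exec_compareProg_loop l l' [] [] hl [] s
  have h4 := exec_move (a := .tmp) (b := .cfg) (by decide) id { s with
    cfg := [], saved := [], tmp := l.reverse ++ [], tmpSaved := l'.reverse ++ [], neq := q }
  have h5 := exec_move (a := .tmpSaved) (b := .saved) (by decide) id { s with
    cfg := l, saved := [], tmp := [], tmpSaved := l'.reverse ++ [], neq := q }
  have e4 : ∀ l : List (Fin (m + 1)), (l.reverse ++ []).reverse.map id ++ [] = l := by simp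
  have h6 : Exec (case .neq fun o => o.elim (push .eqs true) fun _ => clear .neq ⨾ push .eqs false)
      { s with cfg := l, saved := l', tmp := [], tmpSaved := [], neq := q } (2 * l.length + 3)
      { s with
        cfg := l, saved := l', tmp := [], tmpSaved := [], neq := []
        eqs := decide (l = l') :: s.eqs } := by
    obtain _ | ⟨_, q⟩ := q
    · have : l = l' := (h1.1 rfl).2
      refine (Exec.case_nil rfl (Exec.push .eqs true _)).conv (by omega) ?_
      simp [this, Store.set, Store.stk]
    · have : l ≠ l' := fun h => by simpa using h1.2 ⟨rfl, h⟩
      refine (Exec.case_cons (k := .neq) rfl (Exec.seq (exec_clear .neq _)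
        (Exec.push .eqs false _))).conv ?_ ?_
      · simp [Store.set, Store.stk] at h2 ⊢
        omega
      · simp [this, Store.set, Store.stk]
  refine (Exec.seq h3 (Exec.seq (T := 2 * l.length + 1) (h4.conv ?_ ?_)
    (Exec.seq (T := 2 * l.length + 1) (h5.conv ?_ ?_) h6))).mono ?_
  · simp [Store.stk]
  · simp [Store.set, Store.stk]
  · simp [Store.stk, hl]
  · simp [Store.set, Store.stk]
  · omega

/-- Adds a mark to the stack `found` if the last comparison has succeeded and all others have
failed. -/
def verdictProg : StackProg (Sym m) :=
  case .eqs fun o => o.elim skip fun b : Bool =>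
    if b then loop .eqs (fun b : Bool => if b then push .neq () else skip) ⨾
      case .neq fun o => o.elim (push .found ()) fun _ => clear .neq
    else clear .eqs

/-- The list begins with `true` and has no other entry `true`. -/
def OnlyHeadTrue (l : List Bool) : Prop := l.head? = some true ∧ ∀ b ∈ l.tail, b = false

open Classical in
/-- Adds a mark to the list if `p` holds. -/
noncomputable def mark (p : Prop) (l : List Unit) : List Unit := if p then () :: l else l

theorem mark_of {p : Prop} (h : p) (l : List Unit) : mark p l = () :: l := if_pos h

theorem mark_of_not {p : Prop} (h : ¬ p) (l : List Unit) : mark p l = l := if_neg h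

theorem exec_verdictProg_loop (l : List Bool) (q : List Unit) (s : Store m) :
    ∃ q', (q' = [] ↔ q = [] ∧ ∀ b ∈ l, b = false) ∧ q'.length ≤ q.length + l.length ∧
      Exec (loop .eqs (fun b : Bool => if b then push .neq () else skip))
        { s with eqs := l, neq := q } (2 * l.length + 1) { s with eqs := [], neq := q' } := by
  induction l generalizing q with
  | nil => exact ⟨q, by simp, by simp, Exec.loop_nil rfl⟩
  | cons b l ih =>
    obtain ⟨q', h1, h2, h3⟩ := ih (if b then () :: q else q)
    refine ⟨q', ?_, ?_, ?_⟩
    · rw [h1]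
      cases b <;> simp
    · refine h2.trans ?_
      split_ifs <;> simp
      omega
    · refine (Exec.loop_cons (T := 1) (k := .eqs) (x := b) (l := l) rfl ?_ h3).mono ?_
      · cases b
        · exact Exec.skip _
        · exact Exec.push .neq () _
      · simp
        omega

theorem exec_verdictProg (l : List Bool) (s : Store m) :
    Exec verdictProg { s with eqs := l, neq := [] } (4 * l.length + 4)
      { s with
        eqs := [], neq := [], found := mark (OnlyHeadTrue l) s.found } := by
  obtain _ | ⟨b, l⟩ := l
  · exact (Exec.case_nil rfl (Exec.skip _)).conv (by simp) (by simp [mark_of_not, OnlyHeadTrue])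
  refine (Exec.case_cons (k := .eqs) (x := b) (l := l) (T := 4 * l.length + 5) rfl ?_).mono
    (by simp; omega)
  cases b
  · exact (exec_clear .eqs _).conv (by simp [Store.stk, Store.set]; omega)
      (by simp [mark_of_not, OnlyHeadTrue, Store.set])
  · obtain ⟨q, h1, h2, h3⟩ := exec_verdictProg_loop l [] s
    refine (Exec.seq (T' := 2 * l.length + 3) h3 ?_).mono (by omega)
    obtain _ | ⟨_, q⟩ := q
    · refine (Exec.case_nil rfl (Exec.push .found () _)).conv (by omega) ?_
      have : ∀ b ∈ l, b = false := (h1.1 rfl).2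
      rw [mark_of ⟨rfl, this⟩]
      rfl
    · refine (Exec.case_cons (k := .neq) rfl (exec_clear .neq _)).conv ?_ ?_
      · simp [Store.stk, Store.set] at h2 ⊢
        omega
      · rw [mark_of_not fun h => by simpa using h1.2 ⟨rfl, h.2⟩]
        rfl

end AutomataNet

namespace AutomataNet

open Function StackProg

variable {m n k : ℕ}

/-! ### Testing one sequence of input letters -/

/-- The configuration reached from `0` by feeding the sequence as many times as there are nodes. -/
noncomputable def reached (P : ModuleCode m n k) (vs : List (Fin k → Fin (m + 1))) : Fin n → Fin (m + 1) :=
  (fun x => vs.foldl P.toModule.update x)^[n] fun _ => 0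

/-- Starts with the configuration `0`. -/
def zeroProg : StackProg (Sym m) :=
  forEach .nodes () .aux () (push .cfg 0) ⨾ forEach .inputs () .auxIn () (push .newIn 0)

theorem exec_zeroProg (n k : ℕ) (s : Store m) :
    Exec zeroProg
      { s with
        nodes := List.replicate n (), aux := [], inputs := List.replicate k (), auxIn := []
        cfg := [], newIn := [] }
      (5 * (n + k) + 4)
      { s with
        nodes := List.replicate n (), aux := [], inputs := List.replicate k (), auxIn := []
        cfg := List.replicate n 0, newIn := List.replicate k 0 } := by
  have h1 := exec_forEach (a := .nodes) (b := .aux) (by decide) () () (p := push .cfg 0) (T := 1)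
    (fun i => { s with
      inputs := List.replicate k (), auxIn := [], cfg := List.replicate i 0, newIn := [] }) n
    (fun i _ l l' => Exec.push .cfg 0 _)
  have h2 := exec_forEach (a := .inputs) (b := .auxIn) (by decide) () () (p := push .newIn 0) (T := 1)
    (fun i => { s with
      nodes := List.replicate n (), aux := [], cfg := List.replicate n 0
      newIn := List.replicate i 0 }) k
    (fun i _ l l' => Exec.push .newIn 0 _)
  exact (Exec.seq h1 h2).mono (by omega)

/-- Copies the configuration to the stack `saved`. -/
def saveProg : StackProg (Sym m) :=
  move .cfg .tmp id ⨾ loop .tmp fun x => push .cfg x ⨾ push .saved x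

theorem exec_saveProg (l : List (Fin (m + 1))) (s : Store m) :
    Exec saveProg { s with cfg := l, tmp := [], saved := [] } (5 * l.length + 2)
      { s with cfg := l, tmp := [], saved := l } := by
  have h1 := exec_move (a := .cfg) (b := .tmp) (by decide) id
    { s with cfg := l, tmp := [], saved := [] }
  have h2 : ∀ l l' : List (Fin (m + 1)), Exec (loop .tmp fun x => push .cfg x ⨾ push .saved x)
      { s with cfg := l', tmp := l, saved := l' } (3 * l.length + 1)
      { s with cfg := l.reverse ++ l', tmp := [], saved := l.reverse ++ l' } := by
    intro l
    induction l with
    | nil => intro l'; exact Exec.loop_nil rfl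
    | cons x l ih =>
      intro l'
      exact (Exec.loop_cons (k := .tmp) (x := x) (l := l) rfl
        (Exec.seq (Exec.push .cfg x _) (Exec.push .saved x _)) (ih (x :: l'))).conv
          (by simp; omega) (by simp)
  refine (Exec.seq h1 (h2 (l.reverse.map id ++ []) [])).conv ?_ ?_
  · simp [Store.stk]
    omega
  · simp

/-- Makes as many steps of the wired module as the stack `time` says, and compares the configuration
with the saved one after each step. -/
def orbitProg : StackProg (Sym m) := forEach .time () .aux () (stepProg ⨾ compareProg)

/-- The results of the comparisons during `c` steps, the last one first. -/
def returnTimes (F : Network (Fin n) (Fin (m + 1))) (x : Fin n → Fin (m + 1)) (c : ℕ) :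
    List Bool :=
  ((List.range c).map fun t => decide (F.update^[t + 1] x = x)).reverse

/-- The head records the comparison at time `c`, the tail those at times `1` to `c - 1`. For `c = 0`
there is no head, in agreement with `0 < c`. -/
theorem onlyHeadTrue_returnTimes_iff (F : Network (Fin n) (Fin (m + 1))) (x : Fin n → Fin (m + 1))
    (c : ℕ) : OnlyHeadTrue (returnTimes F x c) ↔ 0 < c ∧ minimalPeriod F.update x = c := by
  obtain _ | c := c
  · simp [OnlyHeadTrue, returnTimes]
  · rw [minimalPeriod_eq_iff _ _ (Nat.succ_pos c)]
    simp only [OnlyHeadTrue, returnTimes, List.range_succ, List.map_append, List.map_cons,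
      List.map_nil, List.reverse_append, List.reverse_cons, List.reverse_nil, List.nil_append,
      List.singleton_append, List.head?_cons, List.tail_cons, List.mem_reverse, List.mem_map,
      List.mem_range, Option.some.injEq, decide_eq_true_eq, forall_exists_index, and_imp,
      forall_apply_eq_imp_iff₂, decide_eq_false_iff_not, Nat.succ_pos, true_and]
    refine and_congr_right fun _ => ⟨fun h t h0 ht => ?_, fun h t ht => h (t + 1) (by omega) (by omega)⟩
    obtain ⟨t, rfl⟩ := Nat.exists_eq_succ_of_ne_zero h0.ne'
    exact h t (by omega)

theorem exec_orbitProg (P : ModuleCode m n k) (ω : Fin k → Fin n) (x : Fin n → Fin (m + 1)) (c : ℕ)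
    (s : Store m) :
    Exec orbitProg
      (ready P ω x { s with
        time := List.replicate c (), aux := [], saved := List.ofFn x, tmpSaved := [], neq := []
        eqs := [] })
      (c * (11 * n + 4 * k + updateTime m n k (moduleWord P ω).length + 12) + 2)
      (ready P ω ((P.toModule.wire ω).update^[c] x) { s with
        time := List.replicate c (), aux := [], saved := List.ofFn x, tmpSaved := [], neq := []
        eqs := returnTimes (P.toModule.wire ω) x c }) := by
  have h := exec_forEach (a := .time) (b := .aux) (by decide) () () (p := stepProg ⨾ compareProg)
    (T := 4 * k + 2 + updateTime m n k (moduleWord P ω).length + (11 * n + 6))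
    (fun i => ready P ω ((P.toModule.wire ω).update^[i] x) { s with
      saved := List.ofFn x, tmpSaved := [], neq := []
      eqs := returnTimes (P.toModule.wire ω) x i }) c ?_
  · exact h.mono (by ring_nf; omega)
  · intro i _ l l'
    have h1 := exec_stepProg P ω ((P.toModule.wire ω).update^[i] x) { s with
      time := l, aux := l', saved := List.ofFn x, tmpSaved := [], neq := []
      eqs := returnTimes (P.toModule.wire ω) x i }
    rw [← iterate_succ_apply' (P.toModule.wire ω).update] at h1
    have h2 := exec_compareProg (List.ofFn ((P.toModule.wire ω).update^[i + 1] x)) (List.ofFn x)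
      (by simp) (ready P ω ((P.toModule.wire ω).update^[i + 1] x) { s with
        time := l, aux := l', eqs := returnTimes (P.toModule.wire ω) x i })
    rw [List.length_ofFn] at h2
    refine (Exec.seq h1 h2).conv le_rfl ?_
    simp only [List.ofFn_inj, returnTimes, List.range_succ, List.map_append, List.reverse_append]
    rfl

/-- Tests whether the sequence on the stack `guess` leads to an attractor of the given size. -/
def trialProg : StackProg (Sym m) :=
  zeroProg ⨾ forEach .nodes () .aux () feedProg ⨾ saveProg ⨾ orbitProg ⨾ verdictProg ⨾
    clear .cfg ⨾ clear .newIn ⨾ clear .saved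

/-- The store between two trials. -/
def idle (P : ModuleCode m n k) (ω : Fin k → Fin n) (c : ℕ) (g : List (Option (Fin (m + 1))))
    (found go : List Unit) : Store m :=
  { word := (moduleWord P ω).reverse, time := List.replicate c (), nodes := List.replicate n ()
    inputs := List.replicate k (), guess := g, found := found, go := go }

/-- A bound for the number of steps of `trialProg`. -/
def trialTime (n k c U : ℕ) : ℕ :=
  n * (c * (7 * k + U + 5) + 6) + c * (11 * n + 4 * k + U + 16) + 14 * n + 7 * k + 17

theorem exec_trialProg (P : ModuleCode m n k) (ω : Fin k → Fin n)
    (vs : List (Fin k → Fin (m + 1))) (found go : List Unit) :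
    Exec trialProg (idle P ω vs.length (encodeGuess vs) found go)
      (trialTime n k vs.length (updateTime m n k (moduleWord P ω).length))
      (idle P ω vs.length (encodeGuess vs)
        (mark (0 < vs.length ∧
          minimalPeriod (P.toModule.wire ω).update (reached P vs) = vs.length) found) go) := by
  set x := reached P vs with hx
  set c := vs.length with hc
  set s := idle P ω c (encodeGuess vs) found go with hs
  have h1 := exec_zeroProg n k s
  have h2 := exec_forEach (a := .nodes) (b := .aux) (by decide) () () (p := feedProg)
    (T := c * (7 * k + updateTime m n k (moduleWord P ω).length + 5) + 2)
    (fun i => ready P ω ((fun x => vs.foldl P.toModule.update x)^[i] fun _ => 0) s) n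
    (fun i _ l l' => by
      rw [iterate_succ_apply']
      exact exec_feedProg P ω vs _ { s with nodes := l, aux := l' })
  have h3 := exec_saveProg (List.ofFn x) (ready P ω x s)
  have h4 := exec_orbitProg P ω x c s
  have h5 := exec_verdictProg (returnTimes (P.toModule.wire ω) x c)
    (ready P ω ((P.toModule.wire ω).update^[c] x) { s with saved := List.ofFn x })
  rw [onlyHeadTrue_returnTimes_iff] at h5
  have h6 := Exec.seq h2 (Exec.seq h3 (Exec.seq h4 (Exec.seq h5 (Exec.seq (exec_clear .cfg _)
    (Exec.seq (exec_clear .newIn _) (exec_clear .saved _))))))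
  -- From the configuration `0` every wiring reads only the letter `0`, so `zeroProg` need not
  -- consult `ω`.
  have e : ready P ω (fun _ => 0) s =
      { s with cfg := List.replicate n 0, newIn := List.replicate k 0 } := by
    rw [← List.ofFn_const, ← List.ofFn_const]
    rfl
  have h7 := Exec.seq h1 (by
    simp only [iterate_zero, id, e] at h6
    exact h6)
  refine h7.conv ?_ rfl
  simp only [Store.stk, Store.set, ready, List.length_ofFn, returnTimes, List.length_reverse,
    List.length_map, List.length_range, trialTime]
  ring_nf
  omega

end AutomataNet

namespace AutomataNet

open Function StackProg

variable {m n k : ℕ}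

/-! ### Enumerating the sequences of input letters -/

/-- All blocks have length `k + 1`, so equal codes split into equal blocks. -/
theorem encodeGuess_injective : Injective (encodeGuess (m := m) (k := k)) := by
  intro vs
  induction vs with
  | nil =>
    rintro (_ | ⟨v', vs'⟩) h
    · rfl
    · simp [encodeGuess] at h
  | cons v vs ih =>
    rintro (_ | ⟨v', vs'⟩) h
    · simp [encodeGuess] at h
    · simp only [encodeGuess, List.flatMap_cons, List.append_assoc] at h
      obtain ⟨h1, h2⟩ := List.append_inj h (by simp)
      rw [ih (List.append_cancel_left h2), List.ofFn_injective (List.reverse_injective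
        (List.map_injective_iff.2 (Option.some_injective _) h1))]

/-- The places of the letters in the code of a sequence of `c` inputs. -/
def guessShape (c k : ℕ) : List Bool :=
  (List.replicate c (List.replicate k true ++ [false])).flatten

theorem guessShape_succ (c k : ℕ) :
    guessShape (c + 1) k = List.replicate k true ++ false :: guessShape c k := by
  simp [guessShape, List.replicate_succ]

theorem count_guessShape (c k : ℕ) : (guessShape c k).count true = k * c := by
  simp [guessShape, List.count_flatten, mul_comm]

theorem length_guessShape (c k : ℕ) : (guessShape c k).length = c * (k + 1) := by
  simp [guessShape]

theorem map_isSome_encodeGuess (vs : List (Fin k → Fin (m + 1))) :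
    (encodeGuess vs).map Option.isSome = guessShape vs.length k := by
  induction vs with
  | nil => rfl
  | cons v vs ih =>
    rw [List.length_cons, guessShape_succ, ← ih]
    simp [encodeGuess, Function.comp_def]

theorem exists_eq_map_some {α : Type} (w : List (Option α)) (j : ℕ)
    (h : w.map Option.isSome = List.replicate j true) : ∃ l : List α, l.length = j ∧ w = l.map some := by
  induction w generalizing j with
  | nil => exact ⟨[], by simpa using congrArg List.length h, rfl⟩
  | cons a w ih =>
    obtain _ | j := j
    · simp at h
    · simp only [List.map_cons, List.replicate_succ, List.cons.injEq] at h
      obtain ⟨l, rfl, rfl⟩ := ih j h.2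
      obtain ⟨a, rfl⟩ := Option.isSome_iff_exists.1 h.1
      exact ⟨a :: l, rfl, rfl⟩

/-- Together with `map_isSome_encodeGuess`, this lets the enumeration of sequences be replaced by
that of words of a fixed shape. -/
theorem exists_eq_encodeGuess (c : ℕ) (w : List (Option (Fin (m + 1))))
    (h : w.map Option.isSome = guessShape c k) :
    ∃ vs : List (Fin k → Fin (m + 1)), vs.length = c ∧ w = encodeGuess vs := by
  induction c generalizing w with
  | zero => exact ⟨[], rfl, by simpa [guessShape, encodeGuess] using h⟩
  | succ c ih =>
    rw [guessShape_succ, List.map_eq_append_iff] at h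
    obtain ⟨w₁, w₂, rfl, h1, h2⟩ := h
    obtain ⟨l, hl, rfl⟩ := exists_eq_map_some w₁ k h1
    obtain ⟨a, w₂, rfl, ha, h3⟩ := List.map_eq_cons_iff.1 h2
    obtain ⟨vs, rfl, rfl⟩ := ih w₂ h3
    obtain rfl : a = none := by simpa using ha
    subst hl
    refine ⟨(fun i => l.reverse.get (i.cast (by simp))) :: vs, rfl, ?_⟩
    have : (List.ofFn fun i : Fin l.length => l.reverse.get (i.cast (by simp))) = l.reverse :=
      List.ext_getElem (by simp) fun i h1 h2 => by simp
    simp only [encodeGuess, List.flatMap_cons, this, List.reverse_reverse, List.append_assoc,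
      List.singleton_append]

/-- The word with letters at the places `true` that is the `j`-th in the order of the base `m + 1`
expansions. -/
def guessOfNat (m : ℕ) : List Bool → ℕ → List (Option (Fin (m + 1)))
  | [], _ => []
  | false :: l, j => none :: guessOfNat m l j
  | true :: l, j => some (Fin.ofNat (m + 1) j) :: guessOfNat m l (j / (m + 1))

theorem map_isSome_guessOfNat (l : List Bool) (j : ℕ) :
    (guessOfNat m l j).map Option.isSome = l := by
  induction l generalizing j with
  | nil => rfl
  | cons b l ih => cases b <;> simp [guessOfNat, ih]

theorem length_guessOfNat (l : List Bool) (j : ℕ) : (guessOfNat m l j).length = l.length := by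
  rw [← List.length_map Option.isSome, map_isSome_guessOfNat]

theorem guessOfNat_true_cons (l : List Bool) (q : ℕ) {r : ℕ} (hr : r < m + 1) :
    guessOfNat m (true :: l) ((m + 1) * q + r) = some ⟨r, hr⟩ :: guessOfNat m l q := by
  rw [guessOfNat, Nat.mul_add_div (Nat.succ_pos m), Nat.div_eq_of_lt hr, add_zero]
  congr 2
  ext
  simp [Fin.ofNat, Nat.mod_eq_of_lt hr]

/-- The letters of `w` are the base `m + 1` digits of `j`, least significant first; the separators
carry no digit. -/
theorem exists_guessOfNat_eq (w : List (Option (Fin (m + 1)))) :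
    ∃ j < (m + 1) ^ (w.map Option.isSome).count true,
      guessOfNat m (w.map Option.isSome) j = w := by
  induction w with
  | nil => exact ⟨0, by simp, rfl⟩
  | cons a w ih =>
    obtain ⟨j, hj, h⟩ := ih
    obtain _ | a := a
    · exact ⟨j, by simpa using hj, by simp [guessOfNat, h]⟩
    · have ha := a.2
      refine ⟨(m + 1) * j + a, ?_, (guessOfNat_true_cons _ j ha).trans (by rw [h])⟩
      simp only [List.map_cons, Option.isSome_some, List.count_cons_self, pow_succ]
      nlinarith

/-- The loop of `nextProg`. -/
def nextLoop : StackProg (Sym m) :=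
  loop .guess fun o => o.elim (push .guessUsed none) fun a =>
    if h : (a : ℕ) < m then
      push .guessUsed (some ⟨a + 1, by omega⟩) ⨾ push .go () ⨾ move .guess .guessUsed id
    else push .guessUsed (some 0)

/-- Replaces the word on the stack `guess` by the next one, and puts a mark on the stack `go` if it
has not been the last one. -/
def nextProg : StackProg (Sym m) := nextLoop ⨾ move .guessUsed .guess id

/-- This is addition of `1` with carry: digits `m` become `0` until a smaller digit is met, which is
raised, and the rest is copied. The mark on `go` is set exactly when the carry is absorbed. -/
theorem exec_nextLoop (l : List Bool) (j : ℕ) (hj : j < (m + 1) ^ l.count true)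
    (gu : List (Option (Fin (m + 1)))) (s : Store m) :
    Exec nextLoop { s with guess := guessOfNat m l j, guessUsed := gu, go := [] } (3 * l.length + 2)
      { s with
        guess := [], guessUsed := (guessOfNat m l (j + 1)).reverse ++ gu
        go := if j + 1 < (m + 1) ^ l.count true then [()] else [] } := by
  induction l generalizing j gu with
  | nil =>
    obtain rfl : j = 0 := by simpa using hj
    exact (Exec.loop_nil rfl).mono (by simp)
  | cons b l ih =>
    cases b
    · refine Exec.conv (show Exec nextLoop
        { s with guess := none :: guessOfNat m l j, guessUsed := gu, go := [] } _ _ from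
        Exec.loop_cons (k := .guess) rfl (Exec.push .guessUsed none _)
          (ih j (by simpa using hj) (none :: gu))) ?_ ?_
      · simp
        omega
      · simp [guessOfNat]
    · obtain ⟨q, r, hr, rfl⟩ : ∃ q r, r < m + 1 ∧ j = (m + 1) * q + r :=
        ⟨_, _, Nat.mod_lt j (Nat.succ_pos m), (Nat.div_add_mod j (m + 1)).symm⟩
      rw [List.count_cons_self, pow_succ] at hj ⊢
      have hq : q < (m + 1) ^ l.count true := by
        by_contra hq
        nlinarith
      rw [guessOfNat_true_cons l q hr]
      obtain h | rfl : r < m ∨ r = m := by omega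
      · rw [add_assoc, guessOfNat_true_cons l q (Nat.succ_lt_succ h), if_pos (by nlinarith)]
        refine Exec.conv (show Exec nextLoop
          { s with guess := some ⟨r, hr⟩ :: guessOfNat m l q, guessUsed := gu, go := [] } _ _ from
          Exec.loop_cons (k := .guess) (T := 1 + (1 + (2 * l.length + 1))) rfl (?_ : Exec
            (dite (r < m) _ _) _ _ _) (Exec.loop_nil (s := { s with
              guess := []
              guessUsed := (guessOfNat m l q).reverse ++ some ⟨r + 1, Nat.succ_lt_succ h⟩ :: gu
              go := [()] }) rfl)) ?_ ?_
        · rw [dif_pos h]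
          refine Exec.seq (Exec.push .guessUsed _ _) (Exec.seq (Exec.push .go () _)
            ((exec_move (a := .guess) (b := .guessUsed) (by decide) id _).conv ?_ ?_))
          · simp [Store.stk, Store.set, length_guessOfNat]
          · simp [Store.stk, Store.set]
        · simp
          omega
        · simp
      -- Here `m` has been replaced by `r`: the digit is maximal, becomes `0`, and the carry passes
      -- to `q`.
      · rw [show (r + 1) * q + r + 1 = (r + 1) * (q + 1) + 0 by ring,
          guessOfNat_true_cons l (q + 1) (Nat.succ_pos r)]
        refine Exec.conv (show Exec nextLoop
          { s with guess := some ⟨r, hr⟩ :: guessOfNat r l q, guessUsed := gu, go := [] } _ _ from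
          Exec.loop_cons (k := .guess) (T := 1) rfl (?_ : Exec (dite (r < r) _ _) _ _ _)
            (ih q hq (some 0 :: gu))) ?_ ?_
        · rw [dif_neg (lt_irrefl r)]
          exact Exec.push .guessUsed _ _
        · simp
          omega
        · have : (r + 1) * (q + 1) + 0 < (r + 1) ^ l.count true * (r + 1) ↔
              q + 1 < (r + 1) ^ l.count true := by
            rw [add_zero, mul_comm]
            exact Nat.mul_lt_mul_right (Nat.succ_pos r)
          rw [add_zero] at this
          simp [this]

theorem exec_nextProg (l : List Bool) (j : ℕ) (hj : j < (m + 1) ^ l.count true) (s : Store m) :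
    Exec nextProg { s with guess := guessOfNat m l j, guessUsed := [], go := [] } (5 * l.length + 3)
      { s with
        guess := guessOfNat m l (j + 1), guessUsed := []
        go := if j + 1 < (m + 1) ^ l.count true then [()] else [] } := by
  refine (Exec.seq (exec_nextLoop l j hj [] s)
    (exec_move (a := .guessUsed) (b := .guess) (by decide) id _)).conv ?_ ?_
  · simp [Store.stk, length_guessOfNat]
    omega
  · simp [Store.stk, Store.set]

/-- Tests all sequences of input letters from the one on the stack `guess` on. -/
def searchLoop : StackProg (Sym m) := loop .go fun _ => trialProg ⨾ nextProg

/-- The sequence of input letters leads to an attractor of size `c`. -/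
def Succeeds (P : ModuleCode m n k) (ω : Fin k → Fin n) (vs : List (Fin k → Fin (m + 1))) : Prop :=
  0 < vs.length ∧ minimalPeriod (P.toModule.wire ω).update (reached P vs) = vs.length

/-- Induction on the number `r` of remaining trials, positive as `go` holds a mark. Each trial adds
at most one mark to `found`, which bounds the cost of clearing it later. -/
theorem exec_searchLoop (P : ModuleCode m n k) (ω : Fin k → Fin n) (c r j : ℕ) (hr : 0 < r)
    (hj : j + r = (m + 1) ^ (k * c)) (found : List Unit) :
    ∃ found',
      (found' = [] ↔ found = [] ∧ ∀ i, j ≤ i → i < (m + 1) ^ (k * c) →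
        ∀ vs, guessOfNat m (guessShape c k) i = encodeGuess vs → ¬ Succeeds P ω vs) ∧
      found'.length ≤ found.length + r ∧
      Exec searchLoop (idle P ω c (guessOfNat m (guessShape c k) j) found [()])
        (r * (trialTime n k c (updateTime m n k (moduleWord P ω).length) + 5 * (c * (k + 1)) + 4) + 1)
        (idle P ω c (guessOfNat m (guessShape c k) ((m + 1) ^ (k * c))) found' []) := by
  induction r generalizing j found with
  | zero => exact absurd hr (lt_irrefl _)
  | succ r ih =>
    obtain ⟨vs, rfl, hvs⟩ := exists_eq_encodeGuess (m := m) (k := k) c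
      (guessOfNat m (guessShape c k) j) (map_isSome_guessOfNat _ _)
    have h1 := exec_trialProg P ω vs found []
    rw [← hvs] at h1
    have h2 := exec_nextProg (m := m) (guessShape vs.length k) j
      (by rw [count_guessShape]; omega)
      (idle P ω vs.length [] (mark (Succeeds P ω vs) found) [])
    rw [count_guessShape, length_guessShape] at h2
    have huniq : ∀ vs', guessOfNat m (guessShape vs.length k) j = encodeGuess vs' → vs' = vs :=
      fun vs' h => encodeGuess_injective (h.symm.trans hvs)
    have hmark : mark (Succeeds P ω vs) found = [] ↔ found = [] ∧ ¬ Succeeds P ω vs := by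
      by_cases h : Succeeds P ω vs
      · rw [mark_of h]
        simp [h]
      · rw [mark_of_not h]
        simp [h]
    have hlen : (mark (Succeeds P ω vs) found).length ≤ found.length + 1 := by
      by_cases h : Succeeds P ω vs
      · rw [mark_of h, List.length_cons]
      · rw [mark_of_not h]
        omega
    obtain rfl | hr := Nat.eq_zero_or_pos r
    · rw [if_neg (by omega)] at h2
      refine ⟨_, hmark.trans (and_congr_right fun _ => ⟨fun h i hi hi' vs' h' => ?_, fun h => ?_⟩),
        hlen, ?_⟩
      · obtain rfl : i = j := by omega
        rwa [huniq vs' h']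
      · exact h j le_rfl (by omega) vs hvs
      · rw [← hj]
        refine Exec.conv (show Exec searchLoop _ _ _ from Exec.loop_cons (k := .go) rfl
          (Exec.seq h1 h2) (Exec.loop_nil rfl)) ?_ rfl
        omega
    · rw [if_pos (by omega)] at h2
      obtain ⟨found', h3, h4, h5⟩ := ih (j + 1) hr (by omega) (mark (Succeeds P ω vs) found)
      refine ⟨found', ?_, by omega, ?_⟩
      · rw [h3, hmark, and_assoc]
        refine and_congr_right fun _ => ⟨fun h i hi hi' vs' h' => ?_, fun h => ⟨?_, ?_⟩⟩
        · obtain rfl | hi := hi.eq_or_lt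
          · rw [huniq vs' h']
            exact h.1
          · exact h.2 i hi hi' vs' h'
        · exact h j le_rfl (by omega) vs hvs
        · exact fun i hi => h i (by omega)
      · refine Exec.conv (show Exec searchLoop _ _ _ from Exec.loop_cons (k := .go) rfl
          (Exec.seq h1 h2) h5) ?_ rfl
        ring_nf
        omega

end AutomataNet

namespace AutomataNet

open Function StackProg

variable {m n k : ℕ}

/-! ### Reading an instance -/

theorem count_encodeNum {t : Token} (h : t ≠ .tick) (h' : t ≠ .sep) (a : ℕ) :
    (encodeNum a).count t = 0 := by
  simp [encodeNum, List.count_replicate, h.symm, h'.symm]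

theorem count_encodeFormula {t : Token} (ht : t = .wireMark ∨ t = .nodeMark)
    (φ : Formula ((Fin n ⊕ Fin k) × Fin m)) : (encodeFormula φ).count t = 0 := by
  induction φ with
  | tru | fls => rcases ht with rfl | rfl <;> rfl
  | atom p =>
    obtain ⟨i | i, a⟩ := p
    all_goals rcases ht with rfl | rfl <;> simp [encodeFormula, encodeAtom, count_encodeNum]
  | neg φ ih => rcases ht with rfl | rfl <;> simpa [encodeFormula] using ih
  | and φ ψ ihφ ihψ => rcases ht with rfl | rfl <;> simpa [encodeFormula] using ⟨ihφ, ihψ⟩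
  | or φ ψ ihφ ihψ => rcases ht with rfl | rfl <;> simpa [encodeFormula] using ⟨ihφ, ihψ⟩

/-- The word does not state `k` and `n`; the algorithm recovers them by counting marks. -/
theorem count_wireMark_moduleWord (P : ModuleCode m n k) (ω : Fin k → Fin n) :
    (moduleWord P ω).count .wireMark = k := by
  simp [moduleWord, List.count_flatten, List.map_ofFn, Function.comp_def, count_encodeNum,
    count_encodeFormula]

theorem count_nodeMark_moduleWord (P : ModuleCode m n k) (ω : Fin k → Fin n) :
    (moduleWord P ω).count .nodeMark = n := by
  simp [moduleWord, List.count_flatten, List.map_ofFn, Function.comp_def, count_encodeNum,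
    count_encodeFormula]

/-- Stores a symbol of the code of the module, and counts the inputs and the nodes. -/
def parseToken (t : Token) : StackProg (Sym m) :=
  push .word t ⨾ if t = .wireMark then push .inputs () else
    if t = .nodeMark then push .nodes () else skip

/-- Reads the code of an instance. -/
def parseProg : StackProg (Sym m) :=
  -- The first symbol other than `tick` ends the number `c`; the inner loop then empties the input,
  -- which also stops the outer one.
  loop .inp fun t => if t = .tick then push .time () else loop .inp parseToken

theorem exec_parseLoop (w : List Token) (s : Store m) :
    Exec (loop .inp parseToken) { s with inp := w } (3 * w.length + 1)
      { s with
        inp := [], word := w.reverse ++ s.word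
        inputs := List.replicate (w.count .wireMark) () ++ s.inputs
        nodes := List.replicate (w.count .nodeMark) () ++ s.nodes } := by
  induction w generalizing s with
  | nil => exact Exec.loop_nil rfl
  | cons t w ih =>
    have h : Exec (parseToken t) { s with inp := w } 2
        { s with
          inp := w, word := t :: s.word
          inputs := List.replicate (if t = .wireMark then 1 else 0) () ++ s.inputs
          nodes := List.replicate (if t = .nodeMark then 1 else 0) () ++ s.nodes } := by
      refine Exec.seq (Exec.push .word t _) ?_ (T' := 1)
      split_ifs with h1 h2
      · exact absurd (h1.symm.trans h2) (by simp)
      · exact Exec.push .inputs () _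
      · exact Exec.push .nodes () _
      · exact Exec.skip _
    refine Exec.conv (show Exec (loop .inp parseToken) { s with inp := t :: w } _ _ from
      Exec.loop_cons (k := .inp) rfl h (ih { s with
          word := t :: s.word
          inputs := List.replicate (if t = .wireMark then 1 else 0) () ++ s.inputs
          nodes := List.replicate (if t = .nodeMark then 1 else 0) () ++ s.nodes })) ?_ ?_
    · simp
      omega
    · have e : ∀ (a b : ℕ) (l : List Unit), List.replicate (a + b) () ++ l =
          List.replicate a () ++ (List.replicate b () ++ l) := fun a b l => by
        rw [List.replicate_add, List.append_assoc]
      simp only [List.count_cons, beq_iff_eq, e, List.reverse_cons, List.append_assoc,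
        List.cons_append, List.nil_append]

theorem exec_parseProg (w : List Token) (c : ℕ) :
    Exec (parseProg (m := m)) { inp := encodeNum c ++ w } (2 * c + 3 * w.length + 3)
      { word := w.reverse, time := List.replicate c ()
        inputs := List.replicate (w.count .wireMark) ()
        nodes := List.replicate (w.count .nodeMark) () } := by
  have h : ∀ c d, Exec (parseProg (m := m))
      { inp := encodeNum c ++ w, time := List.replicate d () } (2 * c + 3 * w.length + 3)
      { word := w.reverse, time := List.replicate (c + d) ()
        inputs := List.replicate (w.count .wireMark) ()
        nodes := List.replicate (w.count .nodeMark) () } := by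
    intro c
    induction c with
    | zero =>
      intro d
      have h1 := exec_parseLoop (m := m) w { time := List.replicate d () }
      simp only [List.append_nil] at h1
      refine Exec.conv (show Exec parseProg
        { inp := .sep :: w, time := List.replicate d () } _ _ from
        Exec.loop_cons (k := .inp) rfl h1 (Exec.loop_nil rfl)) ?_ ?_
      · omega
      · rw [zero_add]
    | succ c ih =>
      intro d
      refine Exec.conv (show Exec parseProg
        { inp := .tick :: (encodeNum c ++ w), time := List.replicate d () } _ _ from
        Exec.loop_cons (k := .inp) rfl (Exec.push .time () _) (ih (d + 1))) ?_ ?_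
      · omega
      · rw [add_assoc, add_comm 1 d]
  exact h c 0

/-- Prepares the first sequence of input letters. -/
def firstProg : StackProg (Sym m) :=
  forEach .time () .aux () (push .guess none ⨾ forEach .inputs () .auxIn () (push .guess (some 0)))

theorem guessOfNat_zero (l : List Bool) :
    guessOfNat m l 0 = l.map fun b => if b then some 0 else none := by
  induction l with
  | nil => rfl
  | cons b l ih => cases b <;> simp [guessOfNat, ih]

theorem exec_firstProg_block (k : ℕ) (s : Store m) :
    Exec (push .guess none ⨾ forEach .inputs () .auxIn () (push .guess (some 0)))
      { s with inputs := List.replicate k (), auxIn := [] } (5 * k + 3)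
      { s with
        inputs := List.replicate k (), auxIn := []
        guess := List.replicate k (some 0) ++ none :: s.guess } := by
  have h := exec_forEach (a := .inputs) (b := .auxIn) (by decide) () ()
    (p := push .guess (some (0 : Fin (m + 1)))) (T := 1)
    (fun j => { s with guess := List.replicate j (some 0) ++ none :: s.guess }) k
    (fun j _ l l' => (Exec.push .guess (some 0) _).conv le_rfl (by
      rw [List.replicate_succ, List.cons_append]
      rfl))
  exact (Exec.seq (Exec.push .guess none _) h).mono (by omega)

theorem exec_firstProg (k c : ℕ) (s : Store m) :
    Exec firstProg
      { s with
        inputs := List.replicate k (), auxIn := [], time := List.replicate c (), aux := []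
        guess := [] }
      (c * (5 * k + 7) + 2)
      { s with
        inputs := List.replicate k (), auxIn := [], time := List.replicate c (), aux := []
        guess := guessOfNat m (guessShape c k) 0 } := by
  have h := exec_forEach (a := .time) (b := .aux) (by decide) () ()
    (p := push .guess none ⨾ forEach .inputs () .auxIn () (push .guess (some (0 : Fin (m + 1)))))
    (T := 5 * k + 3)
    (fun i => { s with
      inputs := List.replicate k (), auxIn := [], guess := guessOfNat m (guessShape i k) 0 }) c ?_
  · exact h
  · intro i _ l l'
    have e : guessOfNat m (guessShape (i + 1) k) 0 =
        List.replicate k (some 0) ++ none :: guessOfNat m (guessShape i k) 0 := by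
      rw [guessOfNat_zero, guessShape_succ, guessOfNat_zero]
      simp
    rw [e]
    generalize guessOfNat m (guessShape i k) 0 = g
    exact exec_firstProg_block k { s with time := l, aux := l', guess := g }

/-! ### The algorithm -/

/-- Empties all stacks and writes the answer. -/
def answerProg : StackProg (Sym m) :=
  clear .word ⨾ clear .time ⨾ clear .nodes ⨾ clear .inputs ⨾ clear .guess ⨾
    case .found fun o => o.elim (push .out false) fun _ => clear .found ⨾ push .out true

theorem exec_answerProg (P : ModuleCode m n k) (ω : Fin k → Fin n) (c : ℕ)
    (g : List (Option (Fin (m + 1)))) (found : List Unit) :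
    Exec answerProg (idle P ω c g found [])
      (2 * (moduleWord P ω).length + 2 * c + 2 * n + 2 * k + 2 * g.length + 2 * found.length + 7)
      { out := [decide (found ≠ [])] } := by
  have h : Exec (m := m)
      (case .found fun o => o.elim (push .out false) fun _ => clear .found ⨾ push .out true)
      { found := found } (2 * found.length + 2) { out := [decide (found ≠ [])] } := by
    obtain _ | ⟨_, found⟩ := found
    · exact (Exec.case_nil rfl (Exec.push .out false _)).conv (by omega) rfl
    · refine (Exec.case_cons (k := .found) rfl (Exec.seq (exec_clear .found _)
        (Exec.push .out true _))).conv ?_ rfl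
      simp [Store.stk, Store.set]
      omega
  refine (Exec.seq (exec_clear .word _) <| Exec.seq (exec_clear .time _) <|
    Exec.seq (exec_clear .nodes _) <| Exec.seq (exec_clear .inputs _) <|
    Exec.seq (exec_clear .guess _) h).mono ?_
  simp [Store.stk, Store.set, idle]
  omega

/-- The algorithm for the Acyclic Module Attractor Problem. -/
def attractorProg : StackProg (Sym m) :=
  parseProg ⨾ firstProg ⨾ push .go () ⨾ searchLoop ⨾ answerProg

theorem AttractorInstance.encode_eq (J : AttractorInstance m) :
    J.encode = encodeNum J.c ++ moduleWord J.code J.wiring :=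
  List.append_assoc ..

/-- Forwards, acyclicity makes the periodic configuration reachable from `0` by a sequence of length
`c`, and the code of that sequence is one of the enumerated words. Backwards, the length of the word
forces the sequence to have length `c`, and its success gives the cycle. -/
theorem AttractorInstance.hasAttractor_iff (J : AttractorInstance m) :
    J.HasAttractor ↔ ∃ i < (m + 1) ^ (J.k * J.c), ∃ vs,
      guessOfNat m (guessShape J.c J.k) i = encodeGuess vs ∧ Succeeds J.code J.wiring vs := by
  rw [AttractorInstance.HasAttractor, Network.exists_isAttractor_iff]
  constructor
  · rintro ⟨x, hc, hx⟩
    obtain ⟨vs, hvs, h⟩ := J.acyclic.exists_iterate_foldl_eq J.wiring x (fun _ => 0) hc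
      ((minimalPeriod_eq_iff _ _ hc).1 hx).1
    rw [Nat.card_fin] at h
    obtain ⟨i, hi, h'⟩ := exists_guessOfNat_eq (encodeGuess vs)
    rw [map_isSome_encodeGuess, hvs] at hi h'
    rw [count_guessShape] at hi
    refine ⟨i, hi, vs, h', hvs ▸ hc, ?_⟩
    rw [reached, h, hx, hvs]
  · rintro ⟨i, -, vs, h, h0, hx⟩
    have hc : vs.length = J.c := by
      have := congrArg List.length h
      rw [length_guessOfNat, length_guessShape, length_encodeGuess] at this
      exact (Nat.eq_of_mul_eq_mul_right (Nat.succ_pos _) this).symm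
    exact ⟨_, hc ▸ h0, hx.trans hc⟩

/-! ### The time bound of the whole algorithm -/

/-- A bound for the number of steps of `attractorProg` for each sequence of input letters. -/
def attractorTime (m n k c L : ℕ) : ℕ :=
  trialTime n k c (updateTime m n k L) + 14 * (c * (k + 1)) + 5 * L + 2 * n + 2 * k + 6 * c + 24

theorem attractorTime_mono (m : ℕ) {n k c L N : ℕ} (hn : n ≤ N) (hk : k ≤ N) (hc : c ≤ N)
    (hL : L ≤ N) : attractorTime m n k c L ≤ attractorTime m N N N N := by
  unfold attractorTime trialTime updateTime
  gcongr

theorem exists_polynomial_eval_eq_attractorTime (m : ℕ) :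
    ∃ q : Polynomial ℕ, ∀ N, q.eval N = attractorTime m N N N N := by
  let X : Polynomial ℕ := Polynomial.X
  let U : Polynomial ℕ := X * (5 * (X + X) + 2 * (m : Polynomial ℕ) + 12) + 6 * (X + X) + 6
  refine ⟨X * (X * (7 * X + U + 5) + 6) + X * (11 * X + 4 * X + U + 16) + 14 * X + 7 * X + 17 +
    14 * (X * (X + 1)) + 5 * X + 2 * X + 2 * X + 6 * X + 24, fun N => ?_⟩
  simp [X, U, attractorTime, trialTime, updateTime]

theorem exec_attractorProg (J : AttractorInstance m) :
    ∃ b : Bool, (b = true ↔ J.HasAttractor) ∧ ∃ T,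
      Exec (attractorProg (m := m)) { inp := J.encode } T { out := [b] } ∧
      T + 1 ≤ (m + 1) ^ (J.k * J.c) *
        attractorTime m J.n J.k J.c (moduleWord J.code J.wiring).length := by
  have hR : 0 < (m + 1) ^ (J.k * J.c) := by positivity
  obtain ⟨found, h1, h2, h3⟩ := exec_searchLoop J.code J.wiring J.c _ 0 hR (zero_add _) []
  have h4 := exec_parseProg (m := m) (moduleWord J.code J.wiring) J.c
  rw [count_wireMark_moduleWord, count_nodeMark_moduleWord, ← J.encode_eq] at h4
  refine ⟨decide (found ≠ []), ?_, _, Exec.seq h4 (Exec.seq (exec_firstProg J.k J.c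
    (idle J.code J.wiring J.c [] [] []))
    (Exec.seq (Exec.push .go () _) (Exec.seq h3 (exec_answerProg J.code J.wiring J.c _ found)))), ?_⟩
  · rw [decide_eq_true_eq, ne_eq, h1, J.hasAttractor_iff]
    simp only [true_and, not_forall, not_not, zero_le, exists_prop]
  · rw [length_guessOfNat, length_guessShape]
    simp only [List.length_nil, zero_add] at h2
    set R := (m + 1) ^ (J.k * J.c)
    set L := (moduleWord J.code J.wiring).length
    set t := trialTime J.n J.k J.c (updateTime m J.n J.k L) with ht
    -- The three summands pay for the trials, for clearing `found`, and for everything done only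
    -- once; the last is affordable because `R` is at least `1`.
    have e : R * attractorTime m J.n J.k J.c L =
        R * (t + 5 * (J.c * (J.k + 1)) + 4) + R * 2 +
        R * (9 * (J.c * (J.k + 1)) + 5 * L + 2 * J.n + 2 * J.k + 6 * J.c + 18) := by
      rw [attractorTime, ← ht]
      ring
    have e' : 9 * (J.c * (J.k + 1)) + 5 * L + 2 * J.n + 2 * J.k + 6 * J.c + 18 ≤
        R * (9 * (J.c * (J.k + 1)) + 5 * L + 2 * J.n + 2 * J.k + 6 * J.c + 18) :=
      Nat.le_mul_of_pos_left _ hR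
    have e'' : J.c * (5 * J.k + 7) = 5 * (J.c * (J.k + 1)) + 2 * J.c := by ring
    omega

theorem Store.stk_inp (w : List Token) :
    ({ inp := w } : Store m).stk = update (β := fun k => List (Sym m k)) (fun _ => []) .inp w := by
  funext k
  cases k <;> rfl

theorem Store.stk_out (w : List Bool) :
    ({ out := w } : Store m).stk = update (β := fun k => List (Sym m k)) (fun _ => []) .out w := by
  funext k
  cases k <;> rfl

theorem computable_const_pow (a : ℕ) : Computable fun x : ℕ => a ^ x := by
  have h : Primrec fun x : ℕ => (Nat.rec 1 (fun _ y => y * a) x : ℕ) :=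
    Primrec.nat_rec₁ 1 (Primrec.nat_mul.comp Primrec.snd (Primrec.const a)).to₂
  refine (h.of_eq fun x => ?_).to_comp
  induction x with
  | zero => rfl
  | succ x ih => rw [pow_succ, ← ih]

end AutomataNet

theorem mainTheorem5 (m : ℕ) :
    ∃ (f : ℕ → ℕ) (q : Polynomial ℕ), Computable f ∧
      AutomataNet.DecidableInTime
        (AutomataNet.AttractorInstance.encode (m := m))
        AutomataNet.AttractorInstance.HasAttractor
        (fun J => f (J.k * J.c) * q.eval J.encode.length) := by
  obtain ⟨q, hq⟩ := AutomataNet.exists_polynomial_eval_eq_attractorTime m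
  refine ⟨fun x => (m + 1) ^ x, q, AutomataNet.computable_const_pow (m + 1),
    ⟨(AutomataNet.attractorProg (m := m)).toFinTM2 .inp .out, Equiv.refl _, Equiv.refl _⟩, fun J => ?_⟩
  obtain ⟨b, hb, T, ⟨t, ht, h⟩, hT⟩ := AutomataNet.exec_attractorProg J
  rw [AutomataNet.Store.stk_inp, AutomataNet.Store.stk_out] at h
  refine ⟨b, hb, ?_⟩
  have hlen : J.encode.length =
      J.c + 1 + (AutomataNet.moduleWord J.code J.wiring).length := by
    rw [J.encode_eq, List.length_append, AutomataNet.encodeNum]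
    simp
  -- One mark for each node and for each input makes `n` and `k` at most the length of the word, and
  -- the unary code does the same for `c`.
  have hn := AutomataNet.count_nodeMark_moduleWord J.code J.wiring ▸ List.count_le_length
    (a := AutomataNet.Token.nodeMark) (l := AutomataNet.moduleWord J.code J.wiring)
  have hk := AutomataNet.count_wireMark_moduleWord J.code J.wiring ▸ List.count_le_length
    (a := AutomataNet.Token.wireMark) (l := AutomataNet.moduleWord J.code J.wiring)
  have hmono := AutomataNet.attractorTime_mono m (n := J.n) (k := J.k) (c := J.c)
    (L := (AutomataNet.moduleWord J.code J.wiring).length) (N := J.encode.length)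
    (by omega) (by omega) (by omega) (by omega)
  rw [← List.map_id J.encode] at h
  exact h.outputsInTime (T := (m + 1) ^ (J.k * J.c) * q.eval J.encode.length) (by
    rw [hq]
    exact (Nat.succ_le_succ ht).trans (hT.trans (Nat.mul_le_mul_left _ hmono)))
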